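/- Let $\mathbb K$ be a field and let $A=\bigoplus_{n\ge 0}A_n$ be a graded associative $\mathbb K$-algebra that is connected, i.e. $A_0=\mathbb K$; write $\mathbb K=A/A_{\ge 1}$ for the trivial left $A$-module, placed in degree $0$. Call $A$ *weakly Artin–Schelter regular of global dimension $d$* if it is connected, generated in degree one, has (left) global dimension $d$, and satisfies $\operatorname{Ext}^d_A(\mathbb K,A)\cong\mathbb K$ (as vector spaces) and $\operatorname{Ext}^j_A(\mathbb K,A)=0$ for $j\ne d$ (these are the conditions of Artin–Schelter regularity without polynomial growth). Call $A$ *Koszul* if the minimal graded projective resolution $\cdots\to P_1\to P_0\to\mathbb K\to 0$ is linear, i.e. $P_n$ is generated in degree $n$ for every $n$. For $r\in\mathbb Z$ and $n\ge 0$ let $C^n_r(A)$ be the space of $\mathbb K$-linear maps $f:A^{\otimes n}\to A$ with $f(A_{p_1}\otimes\cdots\otimes A_{p_n})\subseteq A_{p_1+\cdots+p_n+r}$ (where $A_m=0$ for $m<0$), let $C^n_r(A)=0$ for $n<0$, and let $\operatorname{HH}^i_r(A)$, $i\in\mathbb Z$, be the $i$-th cohomology of $C^\bullet_r(A)$ with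 the Hochschild differential $$df(a_1\otimes\cdots\otimes a_{n+1})=a_1f(a_2\otimes\cdots\otimes a_{n+1})+\sum_{i=1}^n(-1)^if(a_1\otimes\cdots\otimes a_ia_{i+1}\otimes\cdots\otimes a_{n+1})+(-1)^{n+1}f(a_1\otimes\cdots\otimes a_n)a_{n+1}.$$ **Proposition.** Let $A$ be a Koszul, connected, weakly Artin–Schelter regular algebra of global dimension $d$. Then $\operatorname{HH}^i_r(A)=0$ for all $r\in\mathbb Z$ whenever $i<0$ or $i>d$; every $\operatorname{HH}^i_r(A)$ is finite-dimensional over $\mathbb K$; and for every $r\in\mathbb Z$ $$\sum_{i=0}^d(-1)^i\dim_{\mathbb K}\operatorname{HH}^i_r(A)=\begin{cases}(-1)^d&\text{if }r+d=0,\\0&\text{if }r+d\ne 0.\end{cases}$$ In particular, if $d\ge 1$, then $\sum_{i=0}^d(-1)^i\dim_{\mathbb K}\operatorname{HH}^i_0(A)=0$. -/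

import Mathlib

universe u v

noncomputable section

open CategoryTheory

namespace GradedHochschild

section Combinatorics

variable {α : Type*}

/-- Two contractions of adjacent entries of a tuple commute up to a shift of the index. -/
theorem contractNth_contractNth {n : ℕ} (op : α → α → α)
    (assoc : ∀ x y z, op (op x y) z = op x (op y z)) (b : Fin (n + 2) → α)
    (i : Fin (n + 2)) (j : Fin (n + 1)) (i' : Fin (n + 1)) (j' : Fin (n + 2))
    (hi : (i' : ℕ) = i) (hj : (j' : ℕ) = j + 1) (h : (i : ℕ) ≤ j) :
    Fin.contractNth j op (Fin.contractNth i op b) =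
      Fin.contractNth i' op (Fin.contractNth j' op b) := by
  funext k
  simp only [Fin.contractNth, Fin.val_castSucc, Fin.val_succ, hi, hj]
  split_ifs <;> first | rfl | omega | exact assoc _ _ _

/-- Changing one entry of a tuple and then contracting. -/
theorem contractNth_update {n : ℕ} (op : α → α → α) (a : Fin (n + 1) → α) (j : Fin n)
    (i : Fin (n + 1)) (x : α) :
    Fin.contractNth j.castSucc op (Function.update a i x) =
      Function.update (Fin.contractNth j.castSucc op a) (j.predAbove i)
        (if i = j.castSucc then op x (a j.succ)
          else if i = j.succ then op (a j.castSucc) x else x) := by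
  funext k
  have hp : ((j.predAbove i : Fin n) : ℕ) = if (j : ℕ) < i then (i : ℕ) - 1 else i := by
    simp only [Fin.predAbove, Fin.lt_def, Fin.val_castSucc]
    split_ifs <;> simp
  simp only [Fin.contractNth, Function.update_apply, Fin.ext_iff, Fin.val_castSucc, Fin.val_succ,
    hp]
  by_cases hkj : (k : ℕ) = j
  · obtain rfl : k = j := Fin.ext hkj
    split_ifs <;> first | rfl | omega
  · split_ifs <;> first | rfl | omega

/-- Contracting two adjacent entries does not change the sum of a tuple. -/
theorem sum_contractNth {M : Type*} [AddCommMonoid M] {n : ℕ} (p : Fin (n + 1) → M) (j : Fin n) :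
    ∑ k, Fin.contractNth j.castSucc (· + ·) p k = ∑ k, p k := by
  rw [Fin.sum_univ_succAbove p j.castSucc, ← Finset.add_sum_erase _ _ (Finset.mem_univ j),
    ← Finset.add_sum_erase _ (fun k => p (j.castSucc.succAbove k)) (Finset.mem_univ j),
    Fin.contractNth_apply_of_eq _ _ _ _ (by simp), ← add_assoc]
  congr 1
  · simp
  · refine Finset.sum_congr rfl fun k hk => ?_
    rw [Fin.contractNth_apply_of_ne]
    intro h
    exact Finset.ne_of_mem_erase hk (Fin.ext (by simpa using h.symm))

end Combinatorics

section Hochschild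

variable {K : Type v} {A : Type u} [Field K] [Ring A] [Algebra K A]

/-- The Hochschild cochains `Hom_K(A^{⊗ n}, A)`, as `K`-multilinear maps `A^n → A`. -/
abbrev Cochain (K : Type v) (A : Type u) [Field K] [Ring A] [Algebra K A] (n : ℕ) : Type u :=
  MultilinearMap K (fun _ : Fin n => A) A

/-- The multilinear map `(a_1, …, a_{n+1}) ↦ f (a_1, …, a_j a_{j+1}, …, a_{n+1})`, where the
factors that are multiplied are the entries `j` and `j + 1`, counted from `0`. -/
def innerFace {n : ℕ} (j : Fin n) (f : Cochain K A n) : Cochain K A (n + 1) where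
  toFun a := f (Fin.contractNth j.castSucc (· * ·) a)
  map_update_add' {dec} a i x y := by
    obtain rfl : dec = instDecidableEqFin (n + 1) := Subsingleton.elim _ _
    simp only [contractNth_update]
    split_ifs <;> simp [add_mul, mul_add]
  map_update_smul' {dec} a i c x := by
    obtain rfl : dec = instDecidableEqFin (n + 1) := Subsingleton.elim _ _
    simp only [contractNth_update]
    split_ifs <;> simp

/-- The multilinear map `(a_1, …, a_{n+1}) ↦ a_1 f (a_2, …, a_{n+1})`. -/
def leftFace {n : ℕ} (f : Cochain K A n) : Cochain K A (n + 1) where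
  toFun a := a 0 * f (fun k => a k.succ)
  map_update_add' {dec} a i x y := by
    obtain rfl : dec = instDecidableEqFin (n + 1) := Subsingleton.elim _ _
    refine Fin.cases ?_ (fun i => ?_) i
    · simp [add_mul]
    · have h (z : A) : (fun k : Fin n => Function.update a i.succ z k.succ) =
          Function.update (fun k => a k.succ) i z := by
        funext k; simp [Function.update_apply]
      have h0 (z : A) : Function.update a i.succ z 0 = a 0 := by
        simp [(Fin.succ_ne_zero i).symm]
      simp [mul_add, h, h0]
  map_update_smul' {dec} a i c x := by
    obtain rfl : dec = instDecidableEqFin (n + 1) := Subsingleton.elim _ _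
    refine Fin.cases ?_ (fun i => ?_) i
    · simp
    · have h (z : A) : (fun k : Fin n => Function.update a i.succ z k.succ) =
          Function.update (fun k => a k.succ) i z := by
        funext k; simp [Function.update_apply]
      have h0 (z : A) : Function.update a i.succ z 0 = a 0 := by
        simp [(Fin.succ_ne_zero i).symm]
      simp [h, h0]

/-- The multilinear map `(a_1, …, a_{n+1}) ↦ f (a_1, …, a_n) a_{n+1}`. -/
def rightFace {n : ℕ} (f : Cochain K A n) : Cochain K A (n + 1) where
  toFun a := f (fun k => a k.castSucc) * a (Fin.last n)
  map_update_add' {dec} a i x y := by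
    obtain rfl : dec = instDecidableEqFin (n + 1) := Subsingleton.elim _ _
    refine Fin.lastCases ?_ (fun i => ?_) i
    · simp [mul_add, Fin.castSucc_ne_last]
    · have h (z : A) : (fun k : Fin n => Function.update a i.castSucc z k.castSucc) =
          Function.update (fun k => a k.castSucc) i z := by
        funext k; simp [Function.update_apply]
      have h0 (z : A) : Function.update a i.castSucc z (Fin.last n) = a (Fin.last n) := by
        simp [(Fin.castSucc_ne_last i).symm]
      simp [add_mul, h, h0]
  map_update_smul' {dec} a i c x := by
    obtain rfl : dec = instDecidableEqFin (n + 1) := Subsingleton.elim _ _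
    refine Fin.lastCases ?_ (fun i => ?_) i
    · simp [Fin.castSucc_ne_last]
    · have h (z : A) : (fun k : Fin n => Function.update a i.castSucc z k.castSucc) =
          Function.update (fun k => a k.castSucc) i z := by
        funext k; simp [Function.update_apply]
      have h0 (z : A) : Function.update a i.castSucc z (Fin.last n) = a (Fin.last n) := by
        simp [(Fin.castSucc_ne_last i).symm]
      simp [h, h0]

/-- The Hochschild differential `C^n(A) → C^{n+1}(A)`. -/
def differential (K : Type v) (A : Type u) [Field K] [Ring A] [Algebra K A] (n : ℕ) :
    Cochain K A n →ₗ[K] Cochain K A (n + 1) where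
  toFun f := leftFace f + ∑ j : Fin n, (-1 : K) ^ ((j : ℕ) + 1) • innerFace j f +
    (-1 : K) ^ (n + 1) • rightFace f
  map_add' f g := by
    ext a
    simp only [leftFace, innerFace, rightFace, _root_.add_apply, _root_.sum_apply,
      _root_.smul_apply, MultilinearMap.coe_mk, mul_add, add_mul, smul_add,
      Finset.sum_add_distrib]
    abel
  map_smul' c f := by
    ext a
    simp only [leftFace, innerFace, rightFace, _root_.add_apply, _root_.sum_apply,
      _root_.smul_apply, MultilinearMap.coe_mk, mul_smul_comm, smul_mul_assoc, smul_add,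
      Finset.smul_sum, RingHom.id_apply, smul_comm c]

theorem differential_apply {n : ℕ} (f : Cochain K A n) (a : Fin (n + 1) → A) :
    differential K A n f a = a 0 * f (fun k => a k.succ) +
      ∑ j : Fin n, (-1 : K) ^ ((j : ℕ) + 1) • f (Fin.contractNth j.castSucc (· * ·) a) +
      (-1 : K) ^ (n + 1) • (f (fun k => a k.castSucc) * a (Fin.last n)) := by
  simp [differential, leftFace, innerFace, rightFace]

/-- The function `(b_0, …, b_{n+1}) ↦ b_0 f (b_1, …, b_n) b_{n+1}` attached to a cochain. -/
def sandwich {n : ℕ} (f : Cochain K A n) (b : Fin (n + 2) → A) : A :=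
  b 0 * f (fun k => b k.succ.castSucc) * b (Fin.last (n + 1))

theorem sandwich_differential {n : ℕ} (f : Cochain K A n) (b : Fin (n + 3) → A) :
    sandwich (differential K A n f) b =
      ∑ j : Fin (n + 2), (-1 : K) ^ (j : ℕ) •
        sandwich f (Fin.contractNth j.castSucc (· * ·) b) := by
  rw [Fin.sum_univ_succ, Fin.sum_univ_castSucc]
  simp only [sandwich, differential_apply, mul_add, add_mul, Finset.mul_sum, Finset.sum_mul,
    mul_smul_comm, smul_mul_assoc]
  rw [add_assoc]
  congr 1
  · simp [Fin.contractNth, mul_assoc]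
  congr 1
  · refine Finset.sum_congr rfl fun j _ => ?_
    have h : (fun k : Fin n => Fin.contractNth j.castSucc.succ.castSucc (· * ·) b
        k.succ.castSucc) =
        Fin.contractNth j.castSucc (· * ·) (fun k : Fin (n + 1) => b k.succ.castSucc) := by
      funext k
      simp [Fin.contractNth]
    rw [h]
    have h0 : Fin.contractNth j.castSucc.succ.castSucc (· * ·) b 0 = b 0 := by
      simp [Fin.contractNth]
    have h1 : Fin.contractNth j.castSucc.succ.castSucc (· * ·) b (Fin.last (n + 1)) =
        b (Fin.last (n + 2)) := by
      rw [Fin.contractNth_apply_of_gt]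
      · simp
      · simp
    rw [h0, h1]
    simp
  · have h : (fun k : Fin n => Fin.contractNth (Fin.last n).succ.castSucc (· * ·) b
        k.succ.castSucc) = fun k : Fin n => b k.castSucc.succ.castSucc := by
      funext k
      rw [Fin.contractNth_apply_of_lt]
      · simp
      · simp
    have h0 : Fin.contractNth (Fin.last n).succ.castSucc (· * ·) b 0 = b 0 := by
      simp [Fin.contractNth]
    have h1 : Fin.contractNth (Fin.last n).succ.castSucc (· * ·) b (Fin.last (n + 1)) =
        b (Fin.last (n + 1)).castSucc * b (Fin.last (n + 2)) := by
      rw [Fin.contractNth_apply_of_eq]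
      · simp
      · simp
    rw [h, h0, h1]
    simp [mul_assoc]

theorem sum_sum_contractNth_eq_zero {n : ℕ} (G : (Fin (n + 2) → A) → A) (b : Fin (n + 4) → A) :
    ∑ ij : Fin (n + 3) × Fin (n + 2), ((-1 : K) ^ (ij.1 : ℕ) * (-1 : K) ^ (ij.2 : ℕ)) •
      G (Fin.contractNth ij.2.castSucc (· * ·) (Fin.contractNth ij.1.castSucc (· * ·) b)) = 0 := by
  let S : Finset (Fin (n + 3) × Fin (n + 2)) := {ij | (ij.1 : ℕ) ≤ (ij.2 : ℕ)}
  rw [← Finset.sum_add_sum_compl S, ← eq_neg_iff_add_eq_zero, ← Finset.sum_neg_distrib]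
  refine Finset.sum_bij (fun ij hij => (ij.2.succ, ij.1.castLT
    (lt_of_le_of_lt (Finset.mem_filter.mp hij).2 ij.2.2))) ?_ ?_ ?_ ?_
  · rintro ⟨i, j⟩ hij
    simp only [S, Finset.compl_filter, Finset.mem_filter_univ, Fin.val_succ,
      Fin.val_castLT] at hij ⊢
    omega
  · rintro ⟨i, j⟩ hij ⟨i', j'⟩ hij' h
    simp only [Prod.mk.injEq, Fin.ext_iff, Fin.val_succ, Fin.val_castLT] at h ⊢
    omega
  · rintro ⟨i, j⟩ hij
    simp only [S, Finset.compl_filter, Finset.mem_filter_univ, not_le] at hij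
    refine ⟨(j.castSucc, i.pred ?_), ?_, ?_⟩
    · rintro rfl
      simp at hij
    · simp only [S, Finset.mem_filter_univ, Fin.val_castSucc, Fin.val_pred]
      omega
    · simp
  · rintro ⟨i, j⟩ hij
    simp only [S, Finset.mem_filter_univ] at hij
    rw [← neg_smul]
    congr 1
    · simp only [Fin.val_succ, Fin.val_castLT]
      ring
    · rw [contractNth_contractNth _ mul_assoc b _ _
        (Fin.castSucc (i.castLT (lt_of_le_of_lt hij j.2))) (j.succ.castSucc) (by simp) (by simp) (by simpa using hij)]

theorem differential_comp_differential (n : ℕ) :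
    differential K A (n + 1) ∘ₗ differential K A n = 0 := by
  ext f a
  have key : ∀ b : Fin (n + 4) → A,
      sandwich (differential K A (n + 1) (differential K A n f)) b = 0 := by
    intro b
    rw [sandwich_differential, ← sum_sum_contractNth_eq_zero (K := K) (sandwich f) b,
      Fintype.sum_prod_type]
    refine Finset.sum_congr rfl fun i _ => ?_
    rw [sandwich_differential, Finset.smul_sum]
    simp only [smul_smul]
  have h := key (Fin.cons 1 (Fin.snoc a 1))
  have e : (Fin.last (n + 3)) = (Fin.last (n + 2)).succ := rfl
  simp only [sandwich, Fin.cons_zero, one_mul, e, Fin.cons_succ, Fin.snoc_last, mul_one,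
    ← Fin.succ_castSucc, Fin.snoc_castSucc] at h
  simpa using h

/-- The homogeneous component of degree `m ∈ ℤ`; it is zero for `m < 0`. -/
def intComponent (𝒜 : ℕ → Submodule K A) : ℤ → Submodule K A
  | Int.ofNat m => 𝒜 m
  | Int.negSucc _ => ⊥

/-- The cochains `f` of internal degree `r`: those with
`f (a_1, …, a_n) ∈ A_{p_1 + ⋯ + p_n + r}` for all homogeneous `a_j ∈ A_{p_j}`. -/
def gradedCochain (𝒜 : ℕ → Submodule K A) (r : ℤ) (n : ℕ) : Submodule K (Cochain K A n) where
  carrier := {f | ∀ (p : Fin n → ℕ) (a : Fin n → A), (∀ j, a j ∈ 𝒜 (p j)) →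
    f a ∈ intComponent 𝒜 ((∑ j, p j : ℕ) + r)}
  add_mem' hf hg p a ha := add_mem (hf p a ha) (hg p a ha)
  zero_mem' _ _ _ := zero_mem _
  smul_mem' c _ hf p a ha := Submodule.smul_mem _ c (hf p a ha)

section Graded

variable (𝒜 : ℕ → Submodule K A) [GradedAlgebra 𝒜]

theorem mul_mem_intComponent_left {p : ℕ} {m : ℤ} {x y : A} (hx : x ∈ 𝒜 p)
    (hy : y ∈ intComponent 𝒜 m) : x * y ∈ intComponent 𝒜 (p + m) := by
  cases m with
  | ofNat m => exact SetLike.GradedMul.mul_mem (A := 𝒜) hx hy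
  | negSucc m =>
    obtain rfl : y = 0 := hy
    simp

theorem mul_mem_intComponent_right {p : ℕ} {m : ℤ} {x y : A} (hx : x ∈ 𝒜 p)
    (hy : y ∈ intComponent 𝒜 m) : y * x ∈ intComponent 𝒜 (m + p) := by
  cases m with
  | ofNat m => exact SetLike.GradedMul.mul_mem (A := 𝒜) hy hx
  | negSucc m =>
    obtain rfl : y = 0 := hy
    simp

theorem differential_mem_gradedCochain (r : ℤ) (n : ℕ) (f : Cochain K A n)
    (hf : f ∈ gradedCochain 𝒜 r n) : differential K A n f ∈ gradedCochain 𝒜 r (n + 1) := by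
  intro p a ha
  rw [differential_apply]
  refine add_mem (add_mem ?_ (sum_mem fun j _ => Submodule.smul_mem _ _ ?_))
    (Submodule.smul_mem _ _ ?_)
  · have h := mul_mem_intComponent_left 𝒜 (ha 0)
      (hf (fun k => p k.succ) (fun k => a k.succ) fun k => ha _)
    rw [Fin.sum_univ_succ]
    convert h using 1
    push_cast
    ring_nf
  · have h := hf (Fin.contractNth j.castSucc (· + ·) p) (Fin.contractNth j.castSucc (· * ·) a)
      (fun k => by
        simp only [Fin.contractNth]
        split_ifs
        · exact ha _
        · exact SetLike.mul_mem_graded (ha _) (ha _)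
        · exact ha _)
    rwa [sum_contractNth] at h
  · have h := mul_mem_intComponent_right 𝒜 (ha (Fin.last n))
      (hf (fun k => p k.castSucc) (fun k => a k.castSucc) fun k => ha _)
    rw [Fin.sum_univ_castSucc]
    convert h using 1
    push_cast
    ring_nf

/-- The complex of Hochschild cochains of internal degree `r`, indexed by `ℕ`. -/
def hochschildComplex (r : ℤ) : CochainComplex (ModuleCat.{u} K) ℕ :=
  CochainComplex.of (fun n => ModuleCat.of K (gradedCochain 𝒜 r n))
    (fun n => ModuleCat.ofHom
      ((differential K A n).restrict (differential_mem_gradedCochain 𝒜 r n)))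
    (fun n => by
      ext f : 2
      exact Subtype.ext (LinearMap.congr_fun (differential_comp_differential (K := K) (A := A) n)
        f.1))

/-- The bigraded Hochschild cohomology `HH^i_r(A)`, for `i : ℤ` and `r : ℤ`: the cohomology of the
complex of cochains of internal degree `r`, which is zero in negative cohomological degrees. -/
def HH (i r : ℤ) : ModuleCat.{u} K :=
  ((hochschildComplex 𝒜 r).extend ComplexShape.embeddingUpNat).homology i

end Graded

end Hochschild

section Regular

variable {K : Type v} {A : Type u} [Field K] [Ring A] [Algebra K A]

/-- `A_0 = K`, through the structure map. -/
def IsConnectedGraded (𝒜 : ℕ → Submodule K A) : Prop :=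
  Nontrivial A ∧ 𝒜 0 = 1

/-- `A` is generated in degree one as a `K`-algebra. -/
def IsGeneratedInDegreeOne (𝒜 : ℕ → Submodule K A) : Prop :=
  Algebra.adjoin K (𝒜 1 : Set A) = ⊤

/-- The left global dimension: the supremum of the projective dimensions of the left modules. -/
def globalDimension (A : Type u) [Ring A] : WithBot ℕ∞ :=
  ⨆ M : ModuleCat.{u} A, projectiveDimension M

variable (𝒜 : ℕ → Submodule K A) [GradedAlgebra 𝒜]

/-- The trivial left module `A / A_{≥ 1}`, which is `K` if `A` is connected. -/
abbrev TrivialModule : Type u :=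
  A ⧸ (HomogeneousIdeal.irrelevant 𝒜).toIdeal

/-- The Gorenstein condition: `Ext^d_A(K, A) = K` and `Ext^j_A(K, A) = 0` for `j ≠ d`, where
`Ext` is taken in the category of left `A`-modules. -/
def IsGorenstein (d : ℕ) : Prop :=
  Nonempty (Abelian.Ext (ModuleCat.of A (TrivialModule 𝒜)) (ModuleCat.of A A) d ≃ₗ[K] K) ∧
    ∀ j : ℕ, j ≠ d →
      Subsingleton (Abelian.Ext (ModuleCat.of A (TrivialModule 𝒜)) (ModuleCat.of A A) j)

/-- Weakly Artin–Schelter regular algebras of global dimension `d`: the conditions of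
Artin–Schelter regularity except for polynomial growth. -/
structure IsWeaklyASRegular (d : ℕ) : Prop where
  connected : IsConnectedGraded 𝒜
  generated : IsGeneratedInDegreeOne 𝒜
  globalDimension_eq : globalDimension A = d
  gorenstein : IsGorenstein 𝒜 d

/-- A graded projective resolution `⋯ → P_1 → P_0 → K → 0` of the trivial left module, where `K`
sits in degree zero and all maps preserve degrees. -/
structure GradedProjectiveResolution where
  /-- The modules of the resolution. -/
  P : ℕ → Type u
  [addCommGroup : ∀ n, AddCommGroup (P n)]
  [module : ∀ n, Module A (P n)]
  /-- The homogeneous components: `component n j` is the part of degree `j` of `P_n`. -/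
  component : ∀ n, ℕ → AddSubgroup (P n)
  isInternal : ∀ n, DirectSum.IsInternal (component n)
  smul_mem : ∀ n i j (a : A) (x : P n), a ∈ 𝒜 i → x ∈ component n j → a • x ∈ component n (i + j)
  projective : ∀ n, Module.Projective A (P n)
  /-- The differential `P_{n+1} → P_n`. -/
  d : ∀ n, P (n + 1) →ₗ[A] P n
  d_mem : ∀ n j x, x ∈ component (n + 1) j → d n x ∈ component n j
  /-- The augmentation `P_0 → K`. -/
  ε : P 0 →ₗ[A] TrivialModule 𝒜
  ε_eq_zero : ∀ j x, j ≠ 0 → x ∈ component 0 j → ε x = 0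
  ε_surjective : Function.Surjective ε
  exact_zero : Function.Exact (d 0) ε
  exact_succ : ∀ n, Function.Exact (d (n + 1)) (d n)

attribute [instance] GradedProjectiveResolution.addCommGroup GradedProjectiveResolution.module

variable {𝒜}

/-- Minimality: the image of each differential lies in `A_{≥ 1} P_n`. -/
def GradedProjectiveResolution.IsMinimal (Q : GradedProjectiveResolution 𝒜) : Prop :=
  ∀ n, LinearMap.range (Q.d n) ≤
    (HomogeneousIdeal.irrelevant 𝒜).toIdeal • (⊤ : Submodule A (Q.P n))

/-- Linearity: the `n`-th module is generated in degree `n`. -/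
def GradedProjectiveResolution.IsLinear (Q : GradedProjectiveResolution 𝒜) : Prop :=
  ∀ n, Submodule.span A (Q.component n n : Set (Q.P n)) = ⊤

variable (𝒜)

/-- Koszul algebras: the minimal graded projective resolution of the trivial module, which is
unique up to isomorphism, is linear. -/
def IsKoszul : Prop :=
  ∃ Q : GradedProjectiveResolution 𝒜, Q.IsMinimal ∧ Q.IsLinear

end Regular

end GradedHochschild

end

/-!
Let `P → K` be the linear resolution of the trivial module, with `b n` generators of degree `n` in
`P n`; as `d` is the global dimension, `b n = 0` for `n > d`. Each quotient `A_{≥m} / A_{≥m+1}` of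
the filtration of the bimodule `A` by degree has trivial actions on both sides, so that its
Hochschild cohomology is `Ext_A(K, A_m)`, of dimension `b n` times `dim A_m` in cohomological degree
`n`, all of it in internal degree `m - n`. Euler characteristics are additive along the filtration,
and `A_{≥m}` has no cohomology of internal degree `r` once `m > d + r`. Hence the Euler
characteristic of `HH_r(A)` is `∑ n ≤ d, (-1) ^ n * b n * dim A_{n+r}`. This is also the Euler
characteristic of the part of degree `r` of the complex `Hom_A(P, A)`, which computes `Ext_A(K, A)`.
The latter is one-dimensional by the Gorenstein condition, and sits in cohomological degree `d` and
internal degree `-d`. The same complex shows that all `A_m` and all `b n` are finite.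
-/

noncomputable section

open CategoryTheory

namespace GradedHochschild

section Homogeneous

open DirectSum in
theorem multilinearMap_eq_sum_decompose {R V W ι κ : Type*} [CommSemiring R] [AddCommMonoid V]
    [Module R V] [AddCommMonoid W] [Module R W] [Fintype κ] [DecidableEq κ] [DecidableEq ι]
    (𝒱 : ι → Submodule R V) [Decomposition 𝒱] [∀ i (x : 𝒱 i), Decidable (x ≠ 0)]
    (f : MultilinearMap R (fun _ : κ => V) W) (a : κ → V) :
    f a = ∑ p ∈ Fintype.piFinset fun k => (decompose 𝒱 (a k)).support,
      f fun k => (decompose 𝒱 (a k) (p k) : V) := by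
  rw [← f.map_sum_finset (fun k q => (decompose 𝒱 (a k) q : V))]
  congr 1 with k
  exact (sum_support_decompose 𝒱 (a k)).symm

theorem multilinearMap_ext_homogeneous {R V W ι κ : Type*} [CommSemiring R] [AddCommMonoid V]
    [Module R V] [AddCommMonoid W] [Module R W] [Finite κ] [DecidableEq ι]
    (𝒱 : ι → Submodule R V) [DirectSum.Decomposition 𝒱] {f g : MultilinearMap R (fun _ : κ => V) W}
    (h : ∀ (p : κ → ι) (a : κ → V), (∀ k, a k ∈ 𝒱 (p k)) → f a = g a) : f = g := by
  classical
  have := Fintype.ofFinite κ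
  ext a
  rw [multilinearMap_eq_sum_decompose 𝒱 f, multilinearMap_eq_sum_decompose 𝒱 g]
  exact Finset.sum_congr rfl fun p _ => h p _ fun k => SetLike.coe_mem _

theorem contractNth_mul_mem {ι S B : Type*} [Mul B] [Add ι] [SetLike S B] (𝒜 : ι → S)
    [SetLike.GradedMul 𝒜] {n : ℕ} {p : Fin (n + 1) → ι} {a : Fin (n + 1) → B}
    (ha : ∀ j, a j ∈ 𝒜 (p j)) (j k : Fin n) :
    Fin.contractNth j.castSucc (· * ·) a k ∈ 𝒜 (Fin.contractNth j.castSucc (· + ·) p k) := by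
  simp only [Fin.contractNth]
  split_ifs
  · exact ha _
  · exact SetLike.mul_mem_graded (ha _) (ha _)
  · exact ha _

end Homogeneous

section Coefficients

variable {K : Type v} {A : Type u} [Field K] [Ring A] [Algebra K A]

/-- The Hochschild cochains `Hom_K(A^{⊗ n}, M)` with coefficients in `M`. -/
abbrev BimoduleCochain (K : Type v) (A M : Type u) [Field K] [Ring A] [Algebra K A]
    [AddCommGroup M] [Module K M] (n : ℕ) : Type u :=
  MultilinearMap K (fun _ : Fin n => A) M

variable {M : Type u} [AddCommGroup M] [Module K M] [Module A M] [Module Aᵐᵒᵖ M]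
  [SMulCommClass A Aᵐᵒᵖ M] [IsScalarTower K A M] [IsScalarTower K Aᵐᵒᵖ M] {n : ℕ}

variable (K A M) in
/-- The embedding of the `M`-valued cochains on `A` into the cochains of the square-zero extension
`A ⊕ M`; it is how the bimodule differential is obtained from the differential of an algebra. -/
def inflate (n : ℕ) : BimoduleCochain K A M n →ₗ[K] Cochain K (TrivSqZeroExt A M) n where
  toFun f := ((TrivSqZeroExt.inrHom A M).restrictScalars K).compMultilinearMap
    (f.compLinearMap fun _ => (TrivSqZeroExt.fstHom K A M).toLinearMap)
  map_add' f g := by ext a <;> simp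
  map_smul' c f := by ext a <;> simp

theorem inflate_apply (f : BimoduleCochain K A M n) (a : Fin n → TrivSqZeroExt A M) :
    inflate K A M n f a = TrivSqZeroExt.inr (f fun k => (a k).fst) :=
  rfl

theorem inflate_injective : Function.Injective (inflate K A M n) := by
  intro f g h
  ext a
  simpa [inflate_apply] using
    congrArg TrivSqZeroExt.snd (DFunLike.congr_fun h fun k => TrivSqZeroExt.inl (a k))

variable (K A M) in
/-- The Hochschild differential of cochains with values in an `A`-bimodule `M`. -/
def bimoduleDifferential (n : ℕ) : BimoduleCochain K A M n →ₗ[K]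
    BimoduleCochain K A M (n + 1) where
  toFun f := (TrivSqZeroExt.sndHom A M).restrictScalars K |>.compMultilinearMap
    ((differential K (TrivSqZeroExt A M) n (inflate K A M n f)).compLinearMap
      fun _ => (TrivSqZeroExt.inlAlgHom K A M).toLinearMap)
  map_add' f g := by ext a; simp
  map_smul' c f := by ext a; simp

theorem bimoduleDifferential_apply (f : BimoduleCochain K A M n)
    (a : Fin (n + 1) → A) :
    bimoduleDifferential K A M n f a = a 0 • f (fun k => a k.succ) +
      ∑ j : Fin n, (-1 : K) ^ ((j : ℕ) + 1) • f (Fin.contractNth j.castSucc (· * ·) a) +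
      (-1 : K) ^ (n + 1) • MulOpposite.op (a (Fin.last n)) • f (fun k => a k.castSucc) := by
  have h (j : Fin n) : (fun k => (Fin.contractNth j.castSucc (· * ·)
      (fun i => (TrivSqZeroExt.inl (a i) : TrivSqZeroExt A M)) k).fst) =
      Fin.contractNth j.castSucc (· * ·) a := by
    funext k
    simp only [Fin.contractNth]
    split_ifs <;> simp
  simp [bimoduleDifferential, differential_apply, inflate_apply, h, TrivSqZeroExt.snd_sum]

theorem inflate_bimoduleDifferential (f : BimoduleCochain K A M n) :
    inflate K A M (n + 1) (bimoduleDifferential K A M n f) =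
      differential K (TrivSqZeroExt A M) n (inflate K A M n f) := by
  have h (a : Fin (n + 1) → TrivSqZeroExt A M) (j : Fin n) :
      (fun k => (Fin.contractNth j.castSucc (· * ·) a k).fst) =
        Fin.contractNth j.castSucc (· * ·) fun k => (a k).fst := by
    funext k
    simp only [Fin.contractNth]
    split_ifs <;> simp
  ext a <;> simp [differential_apply, bimoduleDifferential_apply, inflate_apply, h,
    TrivSqZeroExt.snd_sum, TrivSqZeroExt.fst_sum]

theorem bimoduleDifferential_comp_self (n : ℕ) :
    bimoduleDifferential K A M (n + 1) ∘ₗ bimoduleDifferential K A M n = 0 := by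
  ext1 f
  apply inflate_injective
  simpa [inflate_bimoduleDifferential] using
    LinearMap.congr_fun (differential_comp_differential (K := K) n) (inflate K A M n f)

theorem bimoduleDifferential_self (f : Cochain K A n) :
    bimoduleDifferential K A A n f = differential K A n f := by
  ext a
  simp [bimoduleDifferential_apply, differential_apply]

end Coefficients

section GradedCoefficients

variable {K : Type v} {A : Type u} [Field K] [Ring A] [Algebra K A] (𝒜 : ℕ → Submodule K A)
variable {M M' M'' : Type u}
  [AddCommGroup M] [Module K M] [Module A M] [Module Aᵐᵒᵖ M] [SMulCommClass A Aᵐᵒᵖ M]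
  [IsScalarTower K A M] [IsScalarTower K Aᵐᵒᵖ M]
  [AddCommGroup M'] [Module K M'] [Module A M'] [Module Aᵐᵒᵖ M'] [SMulCommClass A Aᵐᵒᵖ M']
  [IsScalarTower K A M'] [IsScalarTower K Aᵐᵒᵖ M']
  [AddCommGroup M''] [Module K M''] [Module A M''] [Module Aᵐᵒᵖ M''] [SMulCommClass A Aᵐᵒᵖ M'']
  [IsScalarTower K A M''] [IsScalarTower K Aᵐᵒᵖ M'']

/-- Compatibility of the module structure of `M` with a family of homogeneous components, which is
not required to span `M`: the components may describe a graded submodule. -/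
class IsGradedLeftModule {M : Type*} [AddCommGroup M] [Module K M] [Module A M]
    (ℳ : ℤ → Submodule K M) : Prop where
  smul_mem : ∀ {p : ℕ} {j : ℤ} {a : A} {x : M}, a ∈ 𝒜 p → x ∈ ℳ j → a • x ∈ ℳ (p + j)

/-- The analogue of `IsGradedLeftModule` for bimodules. -/
class IsGradedBimodule (ℳ : ℤ → Submodule K M) : Prop extends IsGradedLeftModule 𝒜 ℳ where
  op_smul_mem : ∀ {p : ℕ} {j : ℤ} {a : A} {x : M},
    a ∈ 𝒜 p → x ∈ ℳ j → MulOpposite.op a • x ∈ ℳ (j + p)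

/-- The cochains with values in `M` that are homogeneous of internal degree `r`. -/
def gradedBimoduleCochain (ℳ : ℤ → Submodule K M) (r : ℤ) (n : ℕ) :
    Submodule K (BimoduleCochain K A M n) where
  carrier := {f | ∀ (p : Fin n → ℕ) (a : Fin n → A), (∀ j, a j ∈ 𝒜 (p j)) →
    f a ∈ ℳ ((∑ j, p j : ℕ) + r)}
  add_mem' hf hg p a ha := add_mem (hf p a ha) (hg p a ha)
  zero_mem' _ _ _ := zero_mem _
  smul_mem' c _ hf p a ha := Submodule.smul_mem _ c (hf p a ha)

variable [GradedAlgebra 𝒜]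

variable (ℳ : ℤ → Submodule K M) (ℳ' : ℤ → Submodule K M') (ℳ'' : ℤ → Submodule K M'')

/-- Degree-preserving maps `φ` that are bimodule homomorphisms on homogeneous elements. -/
structure IsGradedBimoduleMap (φ : M →ₗ[K] M') : Prop where
  map_mem : ∀ {j : ℤ} {x : M}, x ∈ ℳ j → φ x ∈ ℳ' j
  map_smul : ∀ {p : ℕ} {j : ℤ} {a : A} {x : M}, a ∈ 𝒜 p → x ∈ ℳ j → φ (a • x) = a • φ x
  map_op_smul : ∀ {p : ℕ} {j : ℤ} {a : A} {x : M}, a ∈ 𝒜 p → x ∈ ℳ j →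
    φ (MulOpposite.op a • x) = MulOpposite.op a • φ x

variable {𝒜 ℳ ℳ'} {φ : M →ₗ[K] M'}

theorem IsGradedBimoduleMap.bimoduleDifferential_comp (hφ : IsGradedBimoduleMap 𝒜 ℳ ℳ' φ)
    {r : ℤ} {n : ℕ} {f : BimoduleCochain K A M n} (hf : f ∈ gradedBimoduleCochain 𝒜 ℳ r n) :
    bimoduleDifferential K A M' n (φ.compMultilinearMap f) =
      φ.compMultilinearMap (bimoduleDifferential K A M n f) := by
  refine multilinearMap_ext_homogeneous 𝒜 fun p a ha => ?_
  simp only [bimoduleDifferential_apply, LinearMap.compMultilinearMap_apply, map_add, map_sum,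
    _root_.map_smul]
  rw [hφ.map_smul (ha 0) (hf _ _ fun k => ha _),
    hφ.map_op_smul (ha (Fin.last n)) (hf _ _ fun k => ha _)]

variable (𝒜 ℳ ℳ') [IsGradedBimodule 𝒜 ℳ] [IsGradedBimodule 𝒜 ℳ'] [IsGradedBimodule 𝒜 ℳ'']

theorem bimoduleDifferential_mem {r : ℤ} {n : ℕ} {f : BimoduleCochain K A M n}
    (hf : f ∈ gradedBimoduleCochain 𝒜 ℳ r n) :
    bimoduleDifferential K A M n f ∈ gradedBimoduleCochain 𝒜 ℳ r (n + 1) := by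
  intro p a ha
  rw [bimoduleDifferential_apply]
  refine add_mem (add_mem ?_ (sum_mem fun j _ => Submodule.smul_mem _ _ ?_))
    (Submodule.smul_mem _ _ ?_)
  · have h := IsGradedLeftModule.smul_mem (ha 0) (hf (fun k => p k.succ) (fun k => a k.succ)
      fun k => ha _)
    rw [Fin.sum_univ_succ]
    convert h using 2
    push_cast
    ring
  · have h := hf _ _ (contractNth_mul_mem 𝒜 ha j)
    rwa [sum_contractNth] at h
  · have h := IsGradedBimodule.op_smul_mem (ha (Fin.last n))
      (hf (fun k => p k.castSucc) (fun k => a k.castSucc) fun k => ha _)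
    rw [Fin.sum_univ_castSucc]
    convert h using 2
    push_cast
    ring

/-- The Hochschild differential on the cochains of internal degree `r`. -/
def gradedBimoduleDifferential (r : ℤ) (n : ℕ) :
    gradedBimoduleCochain 𝒜 ℳ r n →ₗ[K] gradedBimoduleCochain 𝒜 ℳ r (n + 1) :=
  (bimoduleDifferential K A M n).restrict fun _ => bimoduleDifferential_mem 𝒜 ℳ

/-- The complex of `M`-valued Hochschild cochains of internal degree `r`. -/
def bimoduleComplex (r : ℤ) : CochainComplex (ModuleCat.{u} K) ℕ :=
  CochainComplex.of (fun n => ModuleCat.of K (gradedBimoduleCochain 𝒜 ℳ r n))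
    (fun n => ModuleCat.ofHom (gradedBimoduleDifferential 𝒜 ℳ r n))
    (fun n => by
      ext f : 2
      exact Subtype.ext (LinearMap.congr_fun (bimoduleDifferential_comp_self n) f.1))

theorem bimoduleComplex_d (r : ℤ) (n : ℕ) :
    (bimoduleComplex 𝒜 ℳ r).d n (n + 1) =
      ModuleCat.ofHom (gradedBimoduleDifferential 𝒜 ℳ r n) :=
  CochainComplex.of_d (fun n => ModuleCat.of K (gradedBimoduleCochain 𝒜 ℳ r n))
    (fun n => ModuleCat.ofHom (gradedBimoduleDifferential 𝒜 ℳ r n)) n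

theorem bimoduleComplex_exactAt_zero_iff (r : ℤ) :
    (bimoduleComplex 𝒜 ℳ r).ExactAt 0 ↔
      ∀ f ∈ gradedBimoduleCochain 𝒜 ℳ r 0, bimoduleDifferential K A M 0 f = 0 → f = 0 := by
  rw [HomologicalComplex.exactAt_iff' _ 0 0 1 (by simp) (by simp),
    ShortComplex.moduleCat_exact_iff_ker_sub_range]
  have hg : ((bimoduleComplex 𝒜 ℳ r).sc' 0 0 1).g =
    ModuleCat.ofHom (gradedBimoduleDifferential 𝒜 ℳ r 0) := bimoduleComplex_d 𝒜 ℳ r 0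
  have hf : ((bimoduleComplex 𝒜 ℳ r).sc' 0 0 1).f = 0 :=
    (bimoduleComplex 𝒜 ℳ r).shape _ _ (by simp)
  rw [hf, hg]
  constructor
  · intro h f hf hd
    obtain ⟨_, hx⟩ := h (x := ⟨f, hf⟩) (Subtype.ext hd)
    exact (congrArg Subtype.val hx).symm
  · intro h f hf
    exact ⟨0, (Subtype.ext (h f.1 f.2 (congrArg Subtype.val hf))).symm⟩

theorem bimoduleComplex_exactAt_succ_iff (r : ℤ) (n : ℕ) :
    (bimoduleComplex 𝒜 ℳ r).ExactAt (n + 1) ↔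
      ∀ f ∈ gradedBimoduleCochain 𝒜 ℳ r (n + 1), bimoduleDifferential K A M (n + 1) f = 0 →
        ∃ g ∈ gradedBimoduleCochain 𝒜 ℳ r n, bimoduleDifferential K A M n g = f := by
  rw [HomologicalComplex.exactAt_iff' _ n (n + 1) (n + 2) (by simp) (by simp),
    ShortComplex.moduleCat_exact_iff_ker_sub_range]
  have hg : ((bimoduleComplex 𝒜 ℳ r).sc' n (n + 1) (n + 2)).g =
    ModuleCat.ofHom (gradedBimoduleDifferential 𝒜 ℳ r (n + 1)) := bimoduleComplex_d 𝒜 ℳ r (n + 1)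
  have hf : ((bimoduleComplex 𝒜 ℳ r).sc' n (n + 1) (n + 2)).f =
    ModuleCat.ofHom (gradedBimoduleDifferential 𝒜 ℳ r n) := bimoduleComplex_d 𝒜 ℳ r n
  rw [hf, hg]
  constructor
  · intro h f hf hd
    obtain ⟨g, hg⟩ := h (x := ⟨f, hf⟩) (Subtype.ext hd)
    exact ⟨g.1, g.2, congrArg Subtype.val hg⟩
  · intro h f hf
    obtain ⟨g, hg, e⟩ := h f.1 f.2 (congrArg Subtype.val hf)
    exact ⟨⟨g, hg⟩, Subtype.ext e⟩

/-- The cohomology in degree zero is the kernel of the first differential. -/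
theorem nonempty_homology_zero_equiv (r : ℤ) :
    Nonempty ((bimoduleComplex 𝒜 ℳ r).homology 0 ≃ₗ[K]
      LinearMap.ker (gradedBimoduleDifferential 𝒜 ℳ r 0)) := by
  let C := bimoduleComplex 𝒜 ℳ r
  let S := C.sc' 0 0 1
  have hg : S.g = ModuleCat.ofHom (gradedBimoduleDifferential 𝒜 ℳ r 0) :=
    bimoduleComplex_d 𝒜 ℳ r 0
  have hf : S.f = 0 := C.shape _ _ (by simp)
  have := S.isIso_homologyπ hf
  have e : LinearMap.ker S.g.hom ≃ₗ[K] LinearMap.ker (gradedBimoduleDifferential 𝒜 ℳ r 0) :=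
    LinearEquiv.ofEq _ _ (by rw [hg]; rfl)
  exact ⟨(ShortComplex.homologyMapIso (C.isoSc' 0 0 1 (by simp) (by simp)) ≪≫
    (asIso S.homologyπ).symm ≪≫ S.moduleCatCyclesIso).toLinearEquiv.trans e⟩

variable {𝒜 ℳ ℳ' ℳ''} {ψ : M' →ₗ[K] M''}

/-- The map of complexes induced by a map of bimodules. -/
def IsGradedBimoduleMap.mapComplex (hφ : IsGradedBimoduleMap 𝒜 ℳ ℳ' φ) (r : ℤ) :
    bimoduleComplex 𝒜 ℳ r ⟶ bimoduleComplex 𝒜 ℳ' r :=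
  CochainComplex.ofHom
    (fun n => ModuleCat.ofHom ((φ.compMultilinearMapₗ K).restrict
      fun _ hf p a ha => hφ.map_mem (hf p a ha)))
    (fun n => by
      rw [bimoduleComplex_d, bimoduleComplex_d]
      ext f : 2
      exact Subtype.ext (hφ.bimoduleDifferential_comp f.2))

/-- Short exactness of `M → M' → M''` on homogeneous elements, by means of degree-preserving
`K`-linear splittings `ρ` and `σ`. -/
structure IsSplitExact (ℳ : ℤ → Submodule K M) (ℳ' : ℤ → Submodule K M')
    (ℳ'' : ℤ → Submodule K M'') (φ : M →ₗ[K] M') (ψ : M' →ₗ[K] M'') (ρ : M' →ₗ[K] M)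
    (σ : M'' →ₗ[K] M') : Prop where
  comp_eq_zero : ∀ {j : ℤ} {x : M}, x ∈ ℳ j → ψ (φ x) = 0
  retraction_apply : ∀ {j : ℤ} {x : M}, x ∈ ℳ j → ρ (φ x) = x
  retraction_mem : ∀ {j : ℤ} {x : M'}, x ∈ ℳ' j → ψ x = 0 → ρ x ∈ ℳ j
  apply_retraction : ∀ {j : ℤ} {x : M'}, x ∈ ℳ' j → ψ x = 0 → φ (ρ x) = x
  section_mem : ∀ {j : ℤ} {x : M''}, x ∈ ℳ'' j → σ x ∈ ℳ' j
  apply_section : ∀ {j : ℤ} {x : M''}, x ∈ ℳ'' j → ψ (σ x) = x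

variable {ρ : M' →ₗ[K] M} {σ : M'' →ₗ[K] M'}

theorem IsSplitExact.mapComplex_comp_eq_zero (h : IsSplitExact ℳ ℳ' ℳ'' φ ψ ρ σ)
    (hφ : IsGradedBimoduleMap 𝒜 ℳ ℳ' φ) (hψ : IsGradedBimoduleMap 𝒜 ℳ' ℳ'' ψ) (r : ℤ) :
    hφ.mapComplex r ≫ hψ.mapComplex r = 0 := by
  ext n f : 3
  exact Subtype.ext (multilinearMap_ext_homogeneous 𝒜 fun p a ha => h.comp_eq_zero (f.2 p a ha))

theorem IsSplitExact.shortExact (h : IsSplitExact ℳ ℳ' ℳ'' φ ψ ρ σ)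
    (hφ : IsGradedBimoduleMap 𝒜 ℳ ℳ' φ) (hψ : IsGradedBimoduleMap 𝒜 ℳ' ℳ'' ψ) (r : ℤ) :
    (ShortComplex.mk _ _ (h.mapComplex_comp_eq_zero hφ hψ r)).ShortExact := by
  refine HomologicalComplex.shortExact_of_degreewise_shortExact _ fun n =>
    ModuleCat.shortComplex_shortExact _ (fun f => ⟨fun hf => ?_, ?_⟩) (fun f g hfg => ?_)
      (fun f => ?_)
  · have hf' (a) : ψ (f.1 a) = 0 := congrArg (fun g => g.1 a) hf
    exact ⟨⟨ρ.compMultilinearMap f.1, fun p a ha => h.retraction_mem (f.2 p a ha) (hf' a)⟩,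
      Subtype.ext (multilinearMap_ext_homogeneous 𝒜 fun p a ha =>
        h.apply_retraction (f.2 p a ha) (hf' a))⟩
  · rintro ⟨g, rfl⟩
    exact Subtype.ext (multilinearMap_ext_homogeneous 𝒜 fun p a ha =>
      h.comp_eq_zero (g.2 p a ha))
  · refine Subtype.ext (multilinearMap_ext_homogeneous 𝒜 fun p a ha => ?_)
    rw [← h.retraction_apply (f.2 p a ha), ← h.retraction_apply (g.2 p a ha)]
    exact congrArg (fun g => ρ (g.1 a)) hfg
  · exact ⟨⟨σ.compMultilinearMap f.1, fun p a ha => h.section_mem (f.2 p a ha)⟩,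
      Subtype.ext (multilinearMap_ext_homogeneous 𝒜 fun p a ha => h.apply_section (f.2 p a ha))⟩

end GradedCoefficients

section GradedLinear

variable {K V V' : Type*} [Field K] [AddCommGroup V] [Module K V] [AddCommGroup V'] [Module K V']

theorem exists_pseudoinverse (g : V →ₗ[K] V') : ∃ s : V' →ₗ[K] V, ∀ x, g (s (g x)) = g x := by
  obtain ⟨r, hr⟩ := g.rangeRestrict.exists_rightInverse_of_surjective g.range_rangeRestrict
  obtain ⟨s, hs⟩ := LinearMap.exists_extend r
  refine ⟨s, fun x => ?_⟩
  have h := LinearMap.congr_fun hs (g.rangeRestrict x)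
  have h' := LinearMap.congr_fun hr (g.rangeRestrict x)
  exact (congrArg g h).trans (congrArg Subtype.val h')

theorem exists_graded_pseudoinverse {κ : Type*} [DecidableEq κ] (𝒱 : κ → Submodule K V)
    [DirectSum.Decomposition 𝒱] (𝒱' : κ → Submodule K V') [DirectSum.Decomposition 𝒱']
    (g : V →ₗ[K] V') (hg : ∀ q, ∀ x ∈ 𝒱 q, g x ∈ 𝒱' q) :
    ∃ s : V' →ₗ[K] V, (∀ q, ∀ y ∈ 𝒱' q, s y ∈ 𝒱 q) ∧ ∀ x, g (s (g x)) = g x := by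
  choose s hs using fun q => exists_pseudoinverse (g.restrict (hg q))
  let t : V' →ₗ[K] V := DirectSum.toModule K κ V (fun q => (𝒱 q).subtype ∘ₗ s q) ∘ₗ
    (DirectSum.decomposeLinearEquiv 𝒱').toLinearMap
  have ht (q : κ) (y : 𝒱' q) : t y = s q y := by
    simp [t]
  refine ⟨t, fun q y hy => ?_, fun x => ?_⟩
  · rw [ht q ⟨y, hy⟩]
    exact (s q ⟨y, hy⟩).2
  · induction x using DirectSum.Decomposition.inductionOn 𝒱 with
    | zero => simp
    | @homogeneous q x =>
      rw [ht q ⟨g x, hg q x x.2⟩]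
      exact congrArg Subtype.val (hs q x)
    | add x y hx hy => simp only [map_add, hx, hy]

end GradedLinear

section HomBimodule

variable {K : Type v} {A : Type u} [Field K] [Ring A] [Algebra K A] {𝒜 : ℕ → Submodule K A}
  {N F S W : Type u}
  [AddCommGroup N] [Module K N] [Module A N] [IsScalarTower K A N]
  [AddCommGroup F] [Module K F] [Module A F] [IsScalarTower K A F]
  [AddCommGroup S] [Module K S] [Module A S] [IsScalarTower K A S]
  [AddCommGroup W] [Module K W]

/-- The right action of `A` on `Hom_K(N, W)` through `N`. -/
scoped instance homRightModule : Module Aᵐᵒᵖ (N →ₗ[K] W) :=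
  inferInstanceAs (Module Aᵈᵐᵃ (N →ₗ[K] W))

theorem op_smul_hom_apply (a : A) (φ : N →ₗ[K] W) (x : N) :
    (MulOpposite.op a • φ) x = φ (a • x) :=
  rfl

scoped instance : IsScalarTower K Aᵐᵒᵖ (N →ₗ[K] W) where
  smul_assoc c a φ := by
    ext x
    obtain ⟨a, rfl⟩ := MulOpposite.op_surjective a
    rw [← MulOpposite.op_smul, op_smul_hom_apply, LinearMap.smul_apply, op_smul_hom_apply,
      smul_assoc, map_smul]

/-- The `K`-linear maps `N → W` that are homogeneous of degree `j`. -/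
def homComponent (𝒩 : ℕ → Submodule K N) (𝒲 : ℤ → Submodule K W) (j : ℤ) :
    Submodule K (N →ₗ[K] W) where
  carrier := {φ | ∀ q, ∀ x ∈ 𝒩 q, φ x ∈ 𝒲 (q + j)}
  add_mem' hφ hψ q x hx := add_mem (hφ q x hx) (hψ q x hx)
  zero_mem' _ _ _ := zero_mem _
  smul_mem' c _ hφ q x hx := Submodule.smul_mem _ c (hφ q x hx)

variable {𝒩 : ℕ → Submodule K N} {ℱ : ℕ → Submodule K F} {𝒮 : ℕ → Submodule K S}
  {𝒲 : ℤ → Submodule K W}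

/-- Contravariance of `Hom_K(-, W)`: a short exact sequence `S → F → N` of graded modules with a
graded `K`-linear retraction `ρ` of `i` gives a split exact sequence of graded bimodules. -/
theorem isSplitExact_lcomp {i : S →ₗ[A] F} {p : F →ₗ[A] N} (hip : Function.Exact i p)
    (hp : ∀ q, ∀ y ∈ 𝒩 q, ∃ x ∈ ℱ q, p x = y)
    {σ : N →ₗ[K] F} (hσ : ∀ y, p (σ y) = y) {ρ : F →ₗ[K] S} (hρ : ∀ x, ρ (i x) = x)
    (hρ_mem : ∀ q, ∀ x ∈ ℱ q, ρ x ∈ 𝒮 q) :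
    IsSplitExact (homComponent 𝒩 𝒲) (homComponent ℱ 𝒲) (homComponent 𝒮 𝒲)
      (LinearMap.lcomp K W (p.restrictScalars K)) (LinearMap.lcomp K W (i.restrictScalars K))
      (LinearMap.lcomp K W σ) (LinearMap.lcomp K W ρ) := by
  have factor (φ : F →ₗ[K] W) (hφ : φ ∘ₗ i.restrictScalars K = 0) (x : F) :
      φ (σ (p x)) = φ x := by
    obtain ⟨z, hz⟩ := (hip (σ (p x) - x)).1 (by rw [map_sub, hσ, sub_self])
    rw [← sub_eq_zero, ← map_sub, ← hz]
    exact LinearMap.congr_fun hφ z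
  refine ⟨fun {j φ} _ => ?_, fun {j φ} _ => ?_, fun {j φ} hφ h q y hy => ?_,
    fun {j φ} _ h => ?_, fun {j φ} hφ q x hx => hφ q _ (hρ_mem q x hx), fun {j φ} _ => ?_⟩
  · ext x
    simp [hip.apply_apply_eq_zero]
  · ext y
    simp [hσ]
  · obtain ⟨x, hx, rfl⟩ := hp q y hy
    simpa [factor φ h] using hφ q x hx
  · ext x
    simpa using factor φ h x
  · ext x
    simp [hρ]

variable [Module A W] [IsScalarTower K A W]

scoped instance : SMulCommClass A Aᵐᵒᵖ (N →ₗ[K] W) where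
  smul_comm _ _ _ := rfl

instance homComponent_isGradedBimodule [SetLike.GradedSMul 𝒜 𝒩] [IsGradedLeftModule 𝒜 𝒲] :
    IsGradedBimodule 𝒜 (homComponent 𝒩 𝒲) where
  smul_mem {p j a φ} ha hφ q x hx := by
    rw [show (q : ℤ) + (p + j) = p + (q + j) by ring]
    exact IsGradedLeftModule.smul_mem ha (hφ q x hx)
  op_smul_mem {p j a φ} ha hφ q x hx := by
    have h := hφ (p + q) (a • x) (SetLike.GradedSMul.smul_mem ha hx)
    rwa [show ((p + q : ℕ) : ℤ) + j = q + (j + p) by push_cast; ring] at h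

theorem isGradedBimoduleMap_lcomp (g : F →ₗ[A] N) (hg : ∀ q, ∀ x ∈ ℱ q, g x ∈ 𝒩 q) :
    IsGradedBimoduleMap 𝒜 (homComponent 𝒩 𝒲) (homComponent ℱ 𝒲)
      (LinearMap.lcomp K W (g.restrictScalars K)) where
  map_mem hφ q x hx := hφ q _ (hg q x hx)
  map_smul _ _ := rfl
  map_op_smul {p j a φ} _ _ := by
    ext x
    simp [op_smul_hom_apply]

end HomBimodule

section HomogeneousBasis

variable {K : Type v} {A : Type u} [Field K] [Ring A] [Algebra K A] (𝒜 : ℕ → Submodule K A)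
  [GradedAlgebra 𝒜] {F : Type*} [AddCommGroup F] [Module K F] [Module A F]
  (ℱ : ℕ → Submodule K F) [DirectSum.Decomposition ℱ] [SetLike.GradedSMul 𝒜 ℱ]
  {ι : Type*} (b : Module.Basis ι A F) {s : ℕ}

theorem decompose_smul_of_mem {x : F} (hx : x ∈ ℱ s) (a : A) (p : ℕ) :
    (DirectSum.decompose ℱ (a • x) (p + s) : F) = (DirectSum.decompose 𝒜 a p : A) • x := by
  induction a using DirectSum.Decomposition.inductionOn 𝒜 with
  | zero => simp
  | add a a' ha ha' => simp_all [add_smul, DirectSum.decompose_add]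
  | @homogeneous q a =>
    have hax : (a : A) • x ∈ ℱ (q + s) := SetLike.GradedSMul.smul_mem a.2 hx
    rcases eq_or_ne q p with rfl | hqp
    · rw [DirectSum.decompose_of_mem_same ℱ hax, DirectSum.decompose_of_mem_same 𝒜 a.2]
    · rw [DirectSum.decompose_of_mem_ne ℱ hax (by simpa using hqp),
        DirectSum.decompose_of_mem_ne 𝒜 a.2 hqp, zero_smul]

variable {b} in
theorem decompose_basis_repr (hb : ∀ i, b i ∈ ℱ s) (x : F) (i : ι) (p : ℕ) :
    (DirectSum.decompose 𝒜 (b.repr x i) p : A) =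
      b.repr (DirectSum.decompose ℱ x (p + s) : F) i := by
  classical
  obtain ⟨l, rfl⟩ := b.repr.symm.surjective x
  induction l using Finsupp.induction_linear with
  | zero => simp
  | add l l' hl hl' => simp_all [DirectSum.decompose_add]
  | single j c =>
    rw [b.repr_symm_single, decompose_smul_of_mem 𝒜 ℱ (hb j)]
    by_cases hij : j = i <;> simp [hij]

variable {𝒜} {ℱ b} in
theorem basis_repr_mem (hb : ∀ i, b i ∈ ℱ s) {q : ℕ} {x : F} (hx : x ∈ ℱ q) (i : ι) :
    b.repr x i ∈ intComponent 𝒜 (q - s) := by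
  rcases le_or_gt s q with h | h
  · obtain ⟨k, rfl⟩ := Nat.exists_eq_add_of_le' h
    have hk := decompose_basis_repr 𝒜 ℱ hb x i k
    rw [DirectSum.decompose_of_mem_same ℱ hx] at hk
    rw [show ((k + s : ℕ) : ℤ) - s = Int.ofNat k by simp, ← hk]
    exact SetLike.coe_mem _
  · classical
    have hzero : b.repr x i = 0 := by
      rw [← DirectSum.sum_support_decompose 𝒜 (b.repr x i)]
      refine Finset.sum_eq_zero fun p _ => ?_
      rw [decompose_basis_repr 𝒜 ℱ hb x i p, DirectSum.decompose_of_mem_ne ℱ hx (by omega)]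
      simp
    rw [hzero]
    exact zero_mem _

variable [IsScalarTower K A F] {W : Type*} [AddCommGroup W] [Module K W]

/-- The `K`-linear map `F → W` with `c • b i ↦ h c (b i)`. -/
def diagonalConstr (b : Module.Basis ι A F) : (A →ₗ[K] F →ₗ[K] W) →ₗ[K] F →ₗ[K] W where
  toFun h := Finsupp.lsum K (fun i => h.flip (b i)) ∘ₗ (b.repr.restrictScalars K).toLinearMap
  map_add' h h' := by
    ext x
    simp [Finsupp.sum, ← Finset.sum_add_distrib]
  map_smul' c h := by
    ext x
    simp only [LinearMap.comp_apply, RingHom.id_apply, LinearMap.smul_apply, Finsupp.coe_lsum,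
      Finsupp.smul_sum]
    rfl

theorem diagonalConstr_apply (h : A →ₗ[K] F →ₗ[K] W) (x : F) :
    diagonalConstr b h x = (b.repr x).sum fun i c => h c (b i) :=
  rfl

theorem diagonalConstr_smul (h : A →ₗ[K] F →ₗ[K] W) (c : A) (i : ι) :
    diagonalConstr b h (c • b i) = h c (b i) := by
  simp [diagonalConstr_apply]

theorem basis_linearMap_ext {K A F W ι : Type*} [Field K] [Ring A] [AddCommGroup F] [Module K F]
    [Module A F] [AddCommGroup W] [Module K W] {b : Module.Basis ι A F} {φ ψ : F →ₗ[K] W}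
    (h : ∀ (c : A) (i : ι), φ (c • b i) = ψ (c • b i)) : φ = ψ := by
  ext x
  rw [← b.linearCombination_repr x, Finsupp.linearCombination_apply, Finsupp.sum, map_sum, map_sum]
  exact Finset.sum_congr rfl fun i _ => h _ _

end HomogeneousBasis

section FreeModule

theorem contractNth_castSucc_snoc {B : Type*} [Mul B] {n : ℕ} (a : Fin (n + 1) → B) (c : B)
    (j : Fin n) : Fin.contractNth j.castSucc.castSucc (· * ·) (Fin.snoc a c : Fin (n + 2) → B) =
      (Fin.snoc (Fin.contractNth j.castSucc (· * ·) a) c : Fin (n + 1) → B) := by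
  funext k
  refine Fin.lastCases ?_ (fun k => ?_) k
  · rw [Fin.contractNth_apply_of_gt _ _ _ _ (by simp)]
    simp
  · simp only [Fin.contractNth, Fin.snoc_castSucc, Fin.val_castSucc, ← Fin.castSucc_succ]

theorem contractNth_last_snoc {B : Type*} [Mul B] {n : ℕ} (a : Fin (n + 1) → B) (c : B) :
    Fin.contractNth (Fin.last n).castSucc (· * ·) (Fin.snoc a c : Fin (n + 2) → B) =
      (Fin.snoc (fun k : Fin n => a k.castSucc) (a (Fin.last n) * c) : Fin (n + 1) → B) := by
  funext k
  refine Fin.lastCases ?_ (fun k => ?_) k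
  · rw [Fin.contractNth_apply_of_eq _ _ _ _ (by simp)]
    simp
  · rw [Fin.contractNth_apply_of_lt _ _ _ _ (by simp)]
    simp

variable {K : Type v} {A : Type u} [Field K] [Ring A] [Algebra K A] {𝒜 : ℕ → Submodule K A}
  [GradedAlgebra 𝒜] {F W : Type u} [AddCommGroup F] [Module K F] [Module A F] [IsScalarTower K A F]
  {ℱ : ℕ → Submodule K F} [DirectSum.Decomposition ℱ] [SetLike.GradedSMul 𝒜 ℱ]
  [AddCommGroup W] [Module K W] {𝒲 : ℤ → Submodule K W} {ι : Type*} (b : Module.Basis ι A F) {s : ℕ}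

/-- The contraction of the Hochschild complex of `Hom_K(F, W)`, for `F` free with basis `b`: up to a
sign, it sends `f` to `(a_1, …, a_n) ↦ (c • b i ↦ f (a_1, …, a_n, c) (b i))`. -/
def freeContraction (n : ℕ) (f : BimoduleCochain K A (F →ₗ[K] W) (n + 1)) :
    BimoduleCochain K A (F →ₗ[K] W) n :=
  (diagonalConstr b).compMultilinearMap f.curryRight

theorem freeContraction_apply {n : ℕ} (f : BimoduleCochain K A (F →ₗ[K] W) (n + 1))
    (a : Fin n → A) (c : A) (i : ι) :
    freeContraction b n f a (c • b i) = f (Fin.snoc a c) (b i) :=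
  diagonalConstr_smul b (f.curryRight a) c i

variable {b} in
theorem freeContraction_mem (hb : ∀ i, b i ∈ ℱ s) {r : ℤ} {n : ℕ}
    {f : BimoduleCochain K A (F →ₗ[K] W) (n + 1)}
    (hf : f ∈ gradedBimoduleCochain 𝒜 (homComponent ℱ 𝒲) r (n + 1)) :
    freeContraction b n f ∈ gradedBimoduleCochain 𝒜 (homComponent ℱ 𝒲) r n := by
  intro p a ha q x hx
  refine sum_mem fun i _ => ?_
  have hi := basis_repr_mem (𝒜 := 𝒜) hb hx i
  change f (Fin.snoc a (b.repr x i)) (b i) ∈ _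
  rcases h : (q : ℤ) - s with k | k
  · replace hi : b.repr x i ∈ 𝒜 k := by rwa [h] at hi
    have hsnoc (j : Fin (n + 1)) : (Fin.snoc a (b.repr x i) : Fin (n + 1) → A) j ∈
        𝒜 ((Fin.snoc p k : Fin (n + 1) → ℕ) j) := by
      refine Fin.lastCases ?_ (fun j => ?_) j
      · simpa using hi
      · simpa using ha j
    have hdeg : (q : ℤ) + ((∑ j, p j : ℕ) + r) =
        s + ((∑ j, (Fin.snoc p k : Fin (n + 1) → ℕ) j : ℕ) + r) := by
      simp only [Fin.sum_univ_castSucc, Fin.snoc_castSucc, Fin.snoc_last, Int.ofNat_eq_natCast]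
        at h ⊢
      push_cast
      linarith
    rw [hdeg]
    exact hf _ _ hsnoc s (b i) (hb i)
  · rw [h] at hi
    have hzero : f (Fin.snoc a (b.repr x i)) = 0 :=
      f.map_coord_zero (Fin.last n) (by simpa [intComponent] using hi)
    rw [hzero]
    exact zero_mem _

variable [Module A W] [IsScalarTower K A W]

theorem bimoduleDifferential_freeContraction {n : ℕ} {f : BimoduleCochain K A (F →ₗ[K] W) (n + 1)}
    (hf : bimoduleDifferential K A (F →ₗ[K] W) (n + 1) f = 0) :
    bimoduleDifferential K A (F →ₗ[K] W) n (freeContraction b n f) = (-1 : K) ^ (n + 1) • f := by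
  ext1 a
  refine basis_linearMap_ext (b := b) fun c i => ?_
  have h := DFunLike.congr_fun (DFunLike.congr_fun hf (Fin.snoc a c)) (b i)
  have hzero : (Fin.snoc a c : Fin (n + 2) → A) 0 = a 0 := by
    rw [← Fin.castSucc_zero, Fin.snoc_castSucc]
  have hsucc : (fun k : Fin (n + 1) => (Fin.snoc a c : Fin (n + 2) → A) k.succ) =
      (Fin.snoc (fun k : Fin n => a k.succ) c : Fin (n + 1) → A) := by
    funext k
    refine Fin.lastCases ?_ (fun k => ?_) k
    · rw [Fin.succ_last]
      simp
    · rw [Fin.succ_castSucc, Fin.snoc_castSucc, Fin.snoc_castSucc]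
  rw [bimoduleDifferential_apply, Fin.sum_univ_castSucc] at h
  simp only [contractNth_castSucc_snoc, contractNth_last_snoc, hzero, hsucc, Fin.snoc_last,
    Fin.snoc_castSucc, LinearMap.add_apply, LinearMap.sum_apply, LinearMap.smul_apply,
    op_smul_hom_apply, Fin.val_castSucc, Fin.val_last, _root_.zero_apply,
    LinearMap.zero_apply] at h
  rw [bimoduleDifferential_apply]
  simp only [LinearMap.add_apply, LinearMap.sum_apply, LinearMap.smul_apply, op_smul_hom_apply,
    freeContraction_apply, smul_smul, _root_.smul_apply] at h ⊢
  rw [← sub_eq_zero, ← h]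
  simp only [pow_succ, mul_neg, mul_one, neg_smul]
  abel

variable [IsGradedLeftModule 𝒜 𝒲]

variable {b} in
theorem exactAt_succ_of_basis (hb : ∀ i, b i ∈ ℱ s) (r : ℤ) (n : ℕ) :
    (bimoduleComplex 𝒜 (homComponent ℱ 𝒲) r).ExactAt (n + 1) := by
  rw [bimoduleComplex_exactAt_succ_iff]
  intro f hf hd
  refine ⟨(-1 : K) ^ (n + 1) • freeContraction b n f,
    Submodule.smul_mem _ _ (freeContraction_mem hb hf), ?_⟩
  rw [map_smul, bimoduleDifferential_freeContraction b hd, smul_smul, ← mul_pow]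
  simp

end FreeModule

section GradedHom

variable {K : Type v} {A : Type u} [Field K] [Ring A] [Algebra K A] {𝒜 : ℕ → Submodule K A}
  {N F W : Type u} [AddCommGroup N] [Module K N] [Module A N] [IsScalarTower K A N]
  [AddCommGroup F] [Module K F] [Module A F] [IsScalarTower K A F]
  [AddCommGroup W] [Module K W] [Module A W]
  (𝒩 : ℕ → Submodule K N) {ℱ : ℕ → Submodule K F} (𝒲 : ℤ → Submodule K W)

variable {𝒲} in
theorem smul_mem_of_mem_intComponent [IsGradedLeftModule 𝒜 𝒲] {p j : ℤ} {c : A} {w : W}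
    (hc : c ∈ intComponent 𝒜 p) (hw : w ∈ 𝒲 j) : c • w ∈ 𝒲 (p + j) := by
  rcases p with p | p
  · exact IsGradedLeftModule.smul_mem (𝒜 := 𝒜) hc hw
  · rw [show c = 0 by simpa [intComponent] using hc, zero_smul]
    exact zero_mem _

variable [IsScalarTower K A W]

/-- The `A`-linear maps `N → W` that are homogeneous of degree `r`. -/
def gradedHom (r : ℤ) : Submodule K (N →ₗ[A] W) :=
  (homComponent 𝒩 𝒲 r).comap (LinearMap.restrictScalarsₗ K A N W K)

variable {𝒩 𝒲} in
theorem mem_gradedHom {r : ℤ} {φ : N →ₗ[A] W} :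
    φ ∈ gradedHom 𝒩 𝒲 r ↔ ∀ q, ∀ x ∈ 𝒩 q, φ x ∈ 𝒲 (q + r) :=
  .rfl

variable {𝒩 𝒲} in
theorem nonempty_gradedHom_equiv_of_surjective {ε : F →ₗ[A] N} (hε : Function.Surjective ε)
    (hmem : ∀ q, ∀ x ∈ ℱ q, ε x ∈ 𝒩 q) (hlift : ∀ q, ∀ y ∈ 𝒩 q, ∃ x ∈ ℱ q, ε x = y) {r : ℤ}
    (hker : ∀ φ ∈ gradedHom (A := A) ℱ 𝒲 r, LinearMap.ker ε ≤ LinearMap.ker φ) :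
    Nonempty (gradedHom (A := A) 𝒩 𝒲 r ≃ₗ[K] gradedHom (A := A) ℱ 𝒲 r) := by
  let comp : gradedHom (A := A) 𝒩 𝒲 r →ₗ[K] gradedHom (A := A) ℱ 𝒲 r :=
    { toFun ψ := ⟨ψ.1 ∘ₗ ε, fun q x hx => ψ.2 q _ (hmem q x hx)⟩
      map_add' _ _ := rfl
      map_smul' _ _ := rfl }
  refine ⟨.ofBijective comp ⟨fun ψ ψ' h => Subtype.ext ?_, fun φ => ?_⟩⟩
  · exact (LinearMap.cancel_right hε).1 (congrArg Subtype.val h)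
  · let ψ := (LinearMap.ker ε).liftQ φ.1 (hker _ φ.2) ∘ₗ
      (ε.quotKerEquivOfSurjective hε).symm.toLinearMap
    have hψ (x : F) : ψ (ε x) = φ.1 x := by
      have h : (ε.quotKerEquivOfSurjective hε).symm (ε x) = Submodule.Quotient.mk x :=
        (LinearEquiv.symm_apply_eq _).2 rfl
      simp [ψ, h]
    refine ⟨⟨ψ, fun q y hy => ?_⟩, Subtype.ext (LinearMap.ext hψ)⟩
    obtain ⟨x, hx, rfl⟩ := hlift q y hy
    change ψ (ε x) ∈ _
    rw [hψ]
    exact φ.2 q x hx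

variable [GradedAlgebra 𝒜]

section Free

variable {𝒲} [DirectSum.Decomposition ℱ] {ι : Type*} {b : Module.Basis ι A F} {s : ℕ}
  (hb : ∀ i, b i ∈ ℱ s)
include hb

variable (𝒜) in
theorem constr_mem_gradedHom [SetLike.GradedSMul 𝒜 ℱ] [IsGradedLeftModule 𝒜 𝒲] {r : ℤ}
    {w : ι → W} (hw : ∀ i, w i ∈ 𝒲 (s + r)) :
    b.constr K w ∈ gradedHom (A := A) ℱ 𝒲 r := fun q x hx => by
  change b.constr K w x ∈ _
  rw [Module.Basis.constr_apply]
  refine sum_mem fun i _ => ?_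
  have h := smul_mem_of_mem_intComponent (basis_repr_mem (𝒜 := 𝒜) hb hx i) (hw i)
  rwa [show (q : ℤ) - s + (s + r) = q + r by ring] at h

theorem nonempty_gradedHom_equiv [SetLike.GradedSMul 𝒜 ℱ] [IsGradedLeftModule 𝒜 𝒲] (r : ℤ) :
    Nonempty (gradedHom (A := A) ℱ 𝒲 r ≃ₗ[K] (ι → 𝒲 (s + r))) := by
  let ev : gradedHom (A := A) ℱ 𝒲 r →ₗ[K] (ι → 𝒲 (s + r)) :=
    { toFun φ i := ⟨φ.1 (b i), φ.2 s (b i) (hb i)⟩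
      map_add' _ _ := rfl
      map_smul' _ _ := rfl }
  refine ⟨.ofBijective ev ⟨fun φ ψ h => Subtype.ext (b.ext fun i => ?_), fun w => ?_⟩⟩
  · exact congrArg Subtype.val (congrFun h i)
  · refine ⟨⟨_, constr_mem_gradedHom 𝒜 hb fun i => (w i).2⟩, ?_⟩
    ext i
    exact b.constr_basis K _ i

end Free

theorem bimoduleDifferential_hom_zero_apply (f : BimoduleCochain K A (N →ₗ[K] W) 0)
    (a : Fin 1 → A) (x : N) :
    bimoduleDifferential K A (N →ₗ[K] W) 0 f a x = a 0 • f ![] x - f ![] (a 0 • x) := by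
  have h (g : Fin 0 → A) : g = ![] := Subsingleton.elim _ _
  simp [bimoduleDifferential_apply, op_smul_hom_apply, h, sub_eq_add_neg]

theorem nonempty_homology_zero_equiv_gradedHom [SetLike.GradedSMul 𝒜 𝒩]
    [IsGradedLeftModule 𝒜 𝒲] (r : ℤ) :
    Nonempty ((bimoduleComplex 𝒜 (homComponent 𝒩 𝒲) r).homology 0 ≃ₗ[K]
      gradedHom (A := A) 𝒩 𝒲 r) := by
  obtain ⟨e⟩ := nonempty_homology_zero_equiv 𝒜 (homComponent 𝒩 𝒲) r
  let const : gradedHom (A := A) 𝒩 𝒲 r →ₗ[K]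
      LinearMap.ker (gradedBimoduleDifferential 𝒜 (homComponent 𝒩 𝒲) r 0) :=
    { toFun φ := ⟨⟨MultilinearMap.constOfIsEmpty K _ (φ.1.restrictScalars K),
          fun p a _ => by simpa using Submodule.mem_comap.1 φ.2⟩,
        Subtype.ext <| MultilinearMap.ext fun a => LinearMap.ext fun x =>
          (bimoduleDifferential_hom_zero_apply _ a x).trans (by simp)⟩
      map_add' _ _ := rfl
      map_smul' _ _ := rfl }
  refine ⟨e.trans (LinearEquiv.ofBijective const ⟨fun φ ψ h => ?_, fun f => ?_⟩).symm⟩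
  · exact Subtype.ext <| LinearMap.ext fun x => congrArg (fun f => f.1.1 ![] x) h
  · have hf (a : A) (x : N) : f.1.1 ![] (a • x) = a • f.1.1 ![] x := by
      have h := (bimoduleDifferential_hom_zero_apply f.1.1 ![a] x).symm.trans
        (congrArg (fun g => g.1 ![a] x) f.2)
      exact (sub_eq_zero.1 h).symm
    have hmem : f.1.1 ![] ∈ homComponent 𝒩 𝒲 r := by simpa using f.1.2 ![] ![] (by simp)
    refine ⟨⟨{ f.1.1 ![] with map_smul' := hf }, hmem⟩, Subtype.ext <| Subtype.ext <|
      MultilinearMap.ext fun a => ?_⟩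
    rw [Subsingleton.elim a ![]]
    rfl

end GradedHom

section ConnectingMap

variable {K : Type v} [Field K]

theorem nonempty_homology_equiv_of_shortExact
    {S : ShortComplex (CochainComplex (ModuleCat.{u} K) ℕ)}
    (hS : S.ShortExact) {n : ℕ} (hzero : HomologicalComplex.homologyMap S.g n = 0)
    (hexact : S.X₂.ExactAt (n + 1)) :
    Nonempty (S.X₁.homology (n + 1) ≃ₗ[K] S.X₃.homology n) := by
  let δ := hS.δ n (n + 1) (by simp)
  have : Mono δ :=
    (hS.homology_exact₃ n (n + 1) (by simp)).mono_g hzero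
  have : Epi δ :=
    (hS.homology_exact₁ n (n + 1) (by simp)).epi_f (hexact.isZero_homology.eq_of_tgt _ _)
  have := isIso_of_mono_of_epi δ
  exact ⟨(asIso δ).toLinearEquiv.symm⟩

end ConnectingMap

section LinearResolution

variable {K : Type v} {A : Type u} [Field K] [Ring A] [Algebra K A] (𝒜 : ℕ → Submodule K A)
  {N : Type u} [AddCommGroup N] [Module K N] [Module A N]

/-- A resolution of the graded module `N` by free modules, the `n`-th of which has a homogeneous
basis in degree `s + n`. As `𝒩` is not required to be a decomposition of `N`, surjectivity of the
augmentation is imposed both on `N` and on its components. -/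
structure LinearResolution (𝒩 : ℕ → Submodule K N) (s : ℕ) where
  P : ℕ → Type u
  [addCommGroup : ∀ n, AddCommGroup (P n)]
  [baseModule : ∀ n, Module K (P n)]
  [module : ∀ n, Module A (P n)]
  [isScalarTower : ∀ n, IsScalarTower K A (P n)]
  component : ∀ n, ℕ → Submodule K (P n)
  [decomposition : ∀ n, DirectSum.Decomposition (component n)]
  [gradedSMul : ∀ n, SetLike.GradedSMul 𝒜 (component n)]
  ι : ℕ → Type u
  basis : ∀ n, Module.Basis (ι n) A (P n)
  basis_mem : ∀ n i, basis n i ∈ component n (s + n)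
  d : ∀ n, P (n + 1) →ₗ[A] P n
  d_mem : ∀ n q, ∀ x ∈ component (n + 1) q, d n x ∈ component n q
  ε : P 0 →ₗ[A] N
  ε_mem : ∀ q, ∀ x ∈ component 0 q, ε x ∈ 𝒩 q
  ε_surjective : Function.Surjective ε
  exists_lift : ∀ q, ∀ y ∈ 𝒩 q, ∃ x ∈ component 0 q, ε x = y
  exact_zero : Function.Exact (d 0) ε
  exact_succ : ∀ n, Function.Exact (d (n + 1)) (d n)

namespace LinearResolution

attribute [instance] addCommGroup baseModule module isScalarTower decomposition gradedSMul

variable {𝒜} {𝒩 : ℕ → Submodule K N} {s : ℕ} (R : LinearResolution 𝒜 𝒩 s)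

/-- The grading of the first syzygy module. -/
def syzygyComponent (q : ℕ) : Submodule K (LinearMap.ker R.ε) :=
  (R.component 0 q).comap ((LinearMap.ker R.ε).subtype.restrictScalars K)

instance : SetLike.GradedSMul 𝒜 R.syzygyComponent where
  smul_mem {p q a x} ha hx :=
    (SetLike.GradedSMul.smul_mem ha hx : a • x.1 ∈ R.component 0 (p +ᵥ q))

theorem exists_pseudoinverse_d_zero : ∃ t : R.P 0 →ₗ[K] R.P 1,
    (∀ q, ∀ x ∈ R.component 0 q, t x ∈ R.component 1 q) ∧ ∀ x, R.d 0 (t (R.d 0 x)) = R.d 0 x :=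
  exists_graded_pseudoinverse (R.component 1) (R.component 0) ((R.d 0).restrictScalars K)
    (R.d_mem 0)

/-- The resolution of the first syzygy module obtained by forgetting `P 0`. -/
def shift : LinearResolution 𝒜 R.syzygyComponent (s + 1) where
  P n := R.P (n + 1)
  component n := R.component (n + 1)
  ι n := R.ι (n + 1)
  basis n := R.basis (n + 1)
  basis_mem n i := by
    rw [show s + 1 + n = s + (n + 1) by ring]
    exact R.basis_mem (n + 1) i
  d n := R.d (n + 1)
  d_mem n := R.d_mem (n + 1)
  ε := (R.d 0).codRestrict _ fun x => R.exact_zero.apply_apply_eq_zero x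
  ε_mem := R.d_mem 0
  ε_surjective := fun ⟨y, hy⟩ => by
    obtain ⟨x, rfl⟩ := (R.exact_zero y).1 hy
    exact ⟨x, rfl⟩
  exists_lift q := fun ⟨y, hy⟩ hq => by
    obtain ⟨x, rfl⟩ := (R.exact_zero y).1 hy
    obtain ⟨t, ht, hdt⟩ := R.exists_pseudoinverse_d_zero
    exact ⟨t (R.d 0 x), ht q _ hq, Subtype.ext (hdt x)⟩
  exact_zero x := by
    rw [← R.exact_succ 0 x]
    exact Subtype.ext_iff
  exact_succ n := R.exact_succ (n + 1)

theorem exists_retraction : ∃ ρ : R.P 0 →ₗ[K] LinearMap.ker R.ε,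
    (∀ x : LinearMap.ker R.ε, ρ x = x) ∧ ∀ q, ∀ x ∈ R.component 0 q, ρ x ∈ R.syzygyComponent q := by
  obtain ⟨t, ht, hdt⟩ := R.exists_pseudoinverse_d_zero
  refine ⟨((R.d 0).restrictScalars K ∘ₗ t).codRestrict
    ((LinearMap.ker R.ε).restrictScalars K) fun x => R.exact_zero.apply_apply_eq_zero _,
    fun ⟨y, hy⟩ => ?_, fun q x hx => R.d_mem 0 q _ (ht q x hx)⟩
  obtain ⟨x, rfl⟩ := (R.exact_zero y).1 hy
  exact Subtype.ext (hdt x)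

variable [IsScalarTower K A N] [GradedAlgebra 𝒜] {W : Type u} [AddCommGroup W] [Module K W]
  [Module A W] [IsScalarTower K A W] {𝒲 : ℤ → Submodule K W} [IsGradedLeftModule 𝒜 𝒲]

omit [GradedAlgebra 𝒜] [IsScalarTower K A N] [IsGradedLeftModule 𝒜 𝒲] in
theorem ker_ε_le_ker_of_concentrated {m : ℤ} (hW : ∀ j ≠ m, 𝒲 j = ⊥) {r : ℤ} {φ : R.P 0 →ₗ[A] W}
    (hφ : φ ∈ gradedHom (R.component 0) 𝒲 r) : LinearMap.ker R.ε ≤ LinearMap.ker φ := by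
  rcases eq_or_ne ((s : ℤ) + r) m with h | h
  · have hd : φ ∘ₗ R.d 0 = 0 := (R.basis 1).ext fun i => by
      have hi := hφ _ _ (R.d_mem 0 _ _ (R.basis_mem 1 i))
      rwa [hW _ (by push_cast; lia)] at hi
    intro x hx
    obtain ⟨y, rfl⟩ := (R.exact_zero x).1 hx
    exact LinearMap.congr_fun hd y
  · have hφ0 : φ = 0 := (R.basis 0).ext fun i => by
      have hi := hφ _ _ (R.basis_mem 0 i)
      rwa [Nat.add_zero, hW _ h] at hi
    simp [hφ0]

theorem nonempty_homology_succ_equiv_shift [SetLike.GradedSMul 𝒜 𝒩] {r : ℤ} {n : ℕ}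
    (hzero : Subsingleton ((bimoduleComplex 𝒜 (homComponent (R.component 0) 𝒲) r).homology n) ∨
      Subsingleton ((bimoduleComplex 𝒜 (homComponent R.syzygyComponent 𝒲) r).homology n)) :
    Nonempty ((bimoduleComplex 𝒜 (homComponent 𝒩 𝒲) r).homology (n + 1) ≃ₗ[K]
      (bimoduleComplex 𝒜 (homComponent R.syzygyComponent 𝒲) r).homology n) := by
  obtain ⟨ρ, hρ, hρ_mem⟩ := R.exists_retraction
  obtain ⟨σ, hσ⟩ := (R.ε.restrictScalars K).exists_rightInverse_of_surjective
    (LinearMap.range_eq_top.2 R.ε_surjective)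
  have hsplit := isSplitExact_lcomp (𝒲 := 𝒲) (i := (LinearMap.ker R.ε).subtype)
    (LinearMap.exact_subtype_ker_map R.ε) R.exists_lift (LinearMap.congr_fun hσ) hρ hρ_mem
  refine nonempty_homology_equiv_of_shortExact (hsplit.shortExact
    (isGradedBimoduleMap_lcomp R.ε R.ε_mem) (isGradedBimoduleMap_lcomp _ fun _ _ hx => hx) r)
    ?_ (exactAt_succ_of_basis (R.basis_mem 0) r n)
  rcases hzero with h | h
  · exact (ModuleCat.isZero_iff_subsingleton.2 h).eq_of_src _ _
  · exact (ModuleCat.isZero_iff_subsingleton.2 h).eq_of_tgt _ _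

omit [IsScalarTower K A N] in
theorem subsingleton_homology_or {m : ℤ} (hW : ∀ j ≠ m, 𝒲 j = ⊥) {r : ℤ} {n : ℕ} {V : Type*}
    [AddCommGroup V] [Module K V] (e : V ≃ₗ[K] (R.shift.ι n → 𝒲 ((s + 1 + n : ℕ) + r))) :
    Subsingleton ((bimoduleComplex 𝒜 (homComponent (R.component 0) 𝒲) r).homology n) ∨
      Subsingleton V := by
  rcases n with _ | n
  · rcases eq_or_ne ((s : ℤ) + r) m with h | h
    · have : Subsingleton (𝒲 ((s + 1 + 0 : ℕ) + r)) :=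
        Submodule.subsingleton_iff_eq_bot.2 (hW _ (by push_cast; lia))
      exact .inr e.toEquiv.subsingleton
    · obtain ⟨e₁⟩ := nonempty_homology_zero_equiv_gradedHom (𝒜 := 𝒜) (R.component 0) 𝒲 r
      obtain ⟨e₂⟩ := nonempty_gradedHom_equiv (𝒜 := 𝒜) (𝒲 := 𝒲) (R.basis_mem 0) r
      have : Subsingleton (𝒲 ((s + 0 : ℕ) + r)) := Submodule.subsingleton_iff_eq_bot.2 (hW _ h)
      exact .inl (e₁.trans e₂).toEquiv.subsingleton
  · exact .inl (ModuleCat.isZero_iff_subsingleton.1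
      (exactAt_succ_of_basis (R.basis_mem 0) r n).isZero_homology)

/-- Dimension shifting. Only the case where all coefficients have the same degree is this simple:
there the maps between the groups `Hom_A(P n, W)` vanish. -/
theorem nonempty_homology_equiv [SetLike.GradedSMul 𝒜 𝒩] {m : ℤ} (hW : ∀ j ≠ m, 𝒲 j = ⊥) (r : ℤ)
    (n : ℕ) : Nonempty ((bimoduleComplex 𝒜 (homComponent 𝒩 𝒲) r).homology n ≃ₗ[K]
      (R.ι n → 𝒲 ((s + n : ℕ) + r))) := by
  induction n generalizing N s with
  | zero =>
    obtain ⟨e₁⟩ := nonempty_homology_zero_equiv_gradedHom (𝒜 := 𝒜) 𝒩 𝒲 r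
    obtain ⟨e₂⟩ := nonempty_gradedHom_equiv_of_surjective R.ε_surjective R.ε_mem R.exists_lift
      fun _ hφ => R.ker_ε_le_ker_of_concentrated hW hφ
    obtain ⟨e₃⟩ := nonempty_gradedHom_equiv (𝒜 := 𝒜) (𝒲 := 𝒲) (R.basis_mem 0) r
    exact ⟨e₁.trans (e₂.trans e₃)⟩
  | succ n ih =>
    obtain ⟨e⟩ := ih R.shift
    obtain ⟨e'⟩ := R.nonempty_homology_succ_equiv_shift (R.subsingleton_homology_or hW e)
    rw [show s + (n + 1) = s + 1 + n by ring]
    exact ⟨e'.trans e⟩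

end LinearResolution

end LinearResolution

section EulerCharacteristic

variable {K : Type v} [Field K]

/-- The cochain complex `C` has finite-dimensional cohomology concentrated in degrees `0, …, d`,
and the Euler characteristic of that cohomology is `χ`. -/
structure HasEulerChar (C : CochainComplex (ModuleCat.{u} K) ℕ) (d : ℕ) (χ : ℤ) : Prop where
  finite (n : ℕ) : Module.Finite K (C.homology n)
  subsingleton (n : ℕ) (hn : d < n) : Subsingleton (C.homology n)
  sum_eq : ∑ n ∈ Finset.range (d + 1), (-1 : ℤ) ^ n * Module.finrank K (C.homology n) = χ

theorem HasEulerChar.of_exactAt {C : CochainComplex (ModuleCat.{u} K) ℕ}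
    (hC : ∀ n, C.ExactAt n) (d : ℕ) : HasEulerChar C d 0 := by
  have hsub (n : ℕ) : Subsingleton (C.homology n) :=
    ModuleCat.isZero_iff_subsingleton.1 (hC n).isZero_homology
  exact ⟨fun n => inferInstance, fun n _ => hsub n,
    Finset.sum_eq_zero fun n _ => by simp [Module.finrank_zero_of_subsingleton]⟩

variable {S : ShortComplex (CochainComplex (ModuleCat.{u} K) ℕ)}

open HomologicalComplex in
theorem finite_homology_of_shortExact (hS : S.ShortExact) (n : ℕ)
    [Module.Finite K (S.X₁.homology n)] [Module.Finite K (S.X₃.homology n)] :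
    Module.Finite K (S.X₂.homology n) := by
  let g := (homologyMap S.g n).hom
  have : Module.Finite K (LinearMap.ker g) := by
    rw [← (hS.homology_exact₂ n).moduleCat_range_eq_ker]
    infer_instance
  have := Module.Finite.equiv g.quotKerEquivRange.symm
  exact Module.Finite.of_submodule_quotient (LinearMap.ker g)

open HomologicalComplex in
theorem finrank_homology_of_shortExact (hS : S.ShortExact) (n : ℕ)
    [Module.Finite K (S.X₁.homology n)] [Module.Finite K (S.X₁.homology (n + 1))]
    [Module.Finite K (S.X₃.homology n)] :
    Module.finrank K (S.X₁.homology n) + Module.finrank K (S.X₃.homology n) =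
      Module.finrank K (S.X₂.homology n) +
        Module.finrank K (LinearMap.ker (homologyMap S.f n).hom) +
        Module.finrank K (LinearMap.ker (homologyMap S.f (n + 1)).hom) := by
  have := finite_homology_of_shortExact hS n
  have exact₁ : LinearMap.range (hS.δ n (n + 1) rfl).hom =
      LinearMap.ker (homologyMap S.f (n + 1)).hom :=
    (hS.homology_exact₁ n (n + 1) rfl).moduleCat_range_eq_ker
  have exact₂ : LinearMap.range (homologyMap S.f n).hom = LinearMap.ker (homologyMap S.g n).hom :=
    (hS.homology_exact₂ n).moduleCat_range_eq_ker
  have exact₃ : LinearMap.range (homologyMap S.g n).hom =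
      LinearMap.ker (hS.δ n (n + 1) rfl).hom :=
    (hS.homology_exact₃ n (n + 1) rfl).moduleCat_range_eq_ker
  have hf := (homologyMap S.f n).hom.finrank_range_add_finrank_ker
  have hg := (homologyMap S.g n).hom.finrank_range_add_finrank_ker
  have hδ := (hS.δ n (n + 1) rfl).hom.finrank_range_add_finrank_ker
  rw [exact₂] at hf
  rw [exact₁, ← exact₃] at hδ
  omega

open HomologicalComplex in
theorem HasEulerChar.of_shortExact (hS : S.ShortExact) {d : ℕ} {χ₁ χ₃ : ℤ}
    (h₁ : HasEulerChar S.X₁ d χ₁) (h₃ : HasEulerChar S.X₃ d χ₃) :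
    HasEulerChar S.X₂ d (χ₁ + χ₃) := by
  have := h₁.finite
  have := h₃.finite
  let ρ (n : ℕ) : ℤ := Module.finrank K (LinearMap.ker (homologyMap S.f n).hom)
  have hrank (n : ℕ) : (Module.finrank K (S.X₂.homology n) : ℤ) = Module.finrank K
      (S.X₁.homology n) + Module.finrank K (S.X₃.homology n) - (ρ n + ρ (n + 1)) := by
    have := finrank_homology_of_shortExact hS n
    lia
  have hzero : ρ 0 = 0 := by
    have := hS.mono_f
    have hmono : Mono (homologyMap S.f 0) :=
      mono_homologyMap_of_mono_of_not_rel _ _ fun i => by simp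
    simp [ρ, LinearMap.ker_eq_bot.2 ((ModuleCat.mono_iff_injective _).1 hmono)]
  have hlast : ρ (d + 1) = 0 := by
    have := h₁.subsingleton _ d.lt_succ_self
    simp [ρ, Module.finrank_zero_of_subsingleton]
  have htelescope (D : ℕ) :
      ∑ n ∈ Finset.range D, (-1 : ℤ) ^ n * (ρ n + ρ (n + 1)) = -(-1) ^ D * ρ D := by
    induction D with
    | zero => simp [hzero]
    | succ D ih => rw [Finset.sum_range_succ, ih, pow_succ]; ring
  refine ⟨fun n => finite_homology_of_shortExact hS n, fun n hn => ?_, ?_⟩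
  · have hX₁ := h₁.subsingleton n hn
    have hX₃ := h₃.subsingleton n hn
    rw [← ModuleCat.isZero_iff_subsingleton] at hX₁ hX₃ ⊢
    exact (hS.homology_exact₂ n).isZero_of_both_zeros (hX₁.eq_of_src _ _) (hX₃.eq_of_tgt _ _)
  · simp only [hrank, mul_sub, mul_add (_ ^ _) (Module.finrank K (S.X₁.homology _) : ℤ),
      Finset.sum_sub_distrib, Finset.sum_add_distrib, h₁.sum_eq, h₃.sum_eq, htelescope, hlast,
      mul_zero, sub_zero]

end EulerCharacteristic

section CompleteFiltration

variable {K : Type v} {A : Type u} [Field K] [Ring A] [Algebra K A] {𝒜 : ℕ → Submodule K A}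
  [GradedAlgebra 𝒜] {M : Type u} [AddCommGroup M] [Module K M] {ℳ : ℕ → ℤ → Submodule K M}
  {r : ℤ} {n : ℕ}

theorem eq_zero_of_forall_mem_gradedBimoduleCochain
    (hbot : ∀ j, ∀ᶠ k in Filter.atTop, ℳ k j = ⊥) {f : BimoduleCochain K A M n}
    (hf : ∀ k, f ∈ gradedBimoduleCochain 𝒜 (ℳ k) r n) : f = 0 := by
  refine multilinearMap_ext_homogeneous 𝒜 fun p a ha => ?_
  obtain ⟨k, hk⟩ := (hbot ((∑ j, p j : ℕ) + r)).exists
  exact (Submodule.mem_bot K).1 (hk ▸ hf k p a ha)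

theorem finite_support_apply (hbot : ∀ j, ∀ᶠ k in Filter.atTop, ℳ k j = ⊥)
    {g : ℕ → BimoduleCochain K A M n} (hg : ∀ k, g k ∈ gradedBimoduleCochain 𝒜 (ℳ k) r n)
    (a : Fin n → A) : (Function.support fun k => g k a).Finite := by
  classical
  rw [Function.support, ← Filter.eventually_cofinite, Nat.cofinite_eq_atTop]
  have hterm (p : Fin n → ℕ) : ∀ᶠ k in Filter.atTop,
      g k (fun j => (DirectSum.decompose 𝒜 (a j) (p j) : A)) = 0 := by
    filter_upwards [hbot ((∑ j, p j : ℕ) + r)] with k hk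
    exact (Submodule.mem_bot K).1 (hk ▸ hg k p _ fun j => SetLike.coe_mem _)
  filter_upwards [(Filter.eventually_all_finset (Fintype.piFinset fun j =>
    (DirectSum.decompose 𝒜 (a j)).support)).2 fun p _ => hterm p] with k hk
  rw [multilinearMap_eq_sum_decompose 𝒜]
  exact Finset.sum_eq_zero hk

theorem exists_sub_sum_mem_gradedBimoduleCochain (hanti : Antitone ℳ)
    (hbot : ∀ j, ∀ᶠ k in Filter.atTop, ℳ k j = ⊥) {g : ℕ → BimoduleCochain K A M n}
    (hg : ∀ k, g k ∈ gradedBimoduleCochain 𝒜 (ℳ k) r n) : ∃ G : BimoduleCochain K A M n,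
      ∀ N, G - ∑ k ∈ Finset.range N, g k ∈ gradedBimoduleCochain 𝒜 (ℳ N) r n := by
  have hfin := finite_support_apply hbot hg
  let G : BimoduleCochain K A M n :=
    { toFun a := ∑ᶠ k, g k a
      map_update_add' a i x y := by
        simp only [MultilinearMap.map_update_add]
        exact finsum_add_distrib (hfin _) (hfin _)
      map_update_smul' a i c x := by
        simp only [MultilinearMap.map_update_smul]
        exact (smul_finsum' c (hfin _)).symm }
  refine ⟨G, fun N p a ha => ?_⟩
  obtain ⟨b, hb⟩ := (hfin a).bddAbove
  have hG : G a = ∑ k ∈ Finset.range (N + (b + 1)), g k a :=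
    finsum_eq_sum_of_support_subset _ fun k hk => by
      have := hb hk
      simp only [Finset.coe_range, Set.mem_Iio]
      lia
  rw [_root_.sub_apply, hG, _root_.sum_apply, Finset.sum_range_add, add_sub_cancel_left]
  exact sum_mem fun k _ => hanti (Nat.le_add_right N k) _ (hg (N + k) p a ha)

variable [Module A M] [Module Aᵐᵒᵖ M] [SMulCommClass A Aᵐᵒᵖ M] [IsScalarTower K A M]
  [IsScalarTower K Aᵐᵒᵖ M]

theorem eq_zero_of_bimoduleDifferential_eq_zero_of_filtration
    (hbot : ∀ j, ∀ᶠ k in Filter.atTop, ℳ k j = ⊥)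
    (hstep : ∀ k, ∀ f ∈ gradedBimoduleCochain 𝒜 (ℳ k) r 0,
      bimoduleDifferential K A M 0 f = 0 → f ∈ gradedBimoduleCochain 𝒜 (ℳ (k + 1)) r 0)
    {f : BimoduleCochain K A M 0} (hf : f ∈ gradedBimoduleCochain 𝒜 (ℳ 0) r 0)
    (hd : bimoduleDifferential K A M 0 f = 0) : f = 0 :=
  eq_zero_of_forall_mem_gradedBimoduleCochain hbot fun k =>
    k.rec hf fun k ih => hstep k f ih hd

variable [∀ k, IsGradedBimodule 𝒜 (ℳ k)]

theorem exists_bimoduleDifferential_eq_of_filtration (hanti : Antitone ℳ)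
    (hbot : ∀ j, ∀ᶠ k in Filter.atTop, ℳ k j = ⊥)
    (hstep : ∀ k, ∀ f ∈ gradedBimoduleCochain 𝒜 (ℳ k) r (n + 1),
      bimoduleDifferential K A M (n + 1) f = 0 → ∃ g ∈ gradedBimoduleCochain 𝒜 (ℳ k) r n,
        f - bimoduleDifferential K A M n g ∈ gradedBimoduleCochain 𝒜 (ℳ (k + 1)) r (n + 1))
    {f : BimoduleCochain K A M (n + 1)} (hf : f ∈ gradedBimoduleCochain 𝒜 (ℳ 0) r (n + 1))
    (hd : bimoduleDifferential K A M (n + 1) f = 0) :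
    ∃ g ∈ gradedBimoduleCochain 𝒜 (ℳ 0) r n, bimoduleDifferential K A M n g = f := by
  choose! c hc hc' using hstep
  let F (k : ℕ) : BimoduleCochain K A M (n + 1) :=
    k.rec f fun k F => F - bimoduleDifferential K A M n (c k F)
  have hF (k : ℕ) : F k ∈ gradedBimoduleCochain 𝒜 (ℳ k) r (n + 1) ∧
      bimoduleDifferential K A M (n + 1) (F k) = 0 := by
    induction k with
    | zero => exact ⟨hf, hd⟩
    | succ k ih =>
      refine ⟨hc' k _ ih.1 ih.2, ?_⟩
      change bimoduleDifferential K A M (n + 1) (F k - _) = 0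
      rw [map_sub, ih.2, zero_sub, neg_eq_zero]
      exact LinearMap.congr_fun (bimoduleDifferential_comp_self n) _
  obtain ⟨G, hG⟩ := exists_sub_sum_mem_gradedBimoduleCochain hanti hbot fun k =>
    hc k (F k) (hF k).1 (hF k).2
  have hF_eq (N : ℕ) :
      F N = f - bimoduleDifferential K A M n (∑ k ∈ Finset.range N, c k (F k)) := by
    induction N with
    | zero => simp [F]
    | succ N ih => rw [Finset.sum_range_succ, map_add, ← sub_sub, ← ih]
  refine ⟨G, by simpa using hG 0, (sub_eq_zero.1 ?_).symm⟩
  refine eq_zero_of_forall_mem_gradedBimoduleCochain (𝒜 := 𝒜) (r := r) hbot fun N => ?_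
  have h := sub_mem (hF N).1 (bimoduleDifferential_mem 𝒜 (ℳ N) (hG N))
  rwa [hF_eq, map_sub, sub_sub, add_sub_cancel] at h

end CompleteFiltration

section SplitExactStep

variable {K : Type v} {A : Type u} [Field K] [Ring A] [Algebra K A] {𝒜 : ℕ → Submodule K A}
  {M M' M'' : Type u} [AddCommGroup M] [Module K M] [AddCommGroup M'] [Module K M']
  [AddCommGroup M''] [Module K M'']
  {ℳ : ℤ → Submodule K M} {ℳ' : ℤ → Submodule K M'} {ℳ'' : ℤ → Submodule K M''}
  {φ : M →ₗ[K] M'} {ψ : M' →ₗ[K] M''} {ρ : M' →ₗ[K] M} {σ : M'' →ₗ[K] M'} {r : ℤ} {n : ℕ}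

theorem IsSplitExact.comp_retraction_mem (h : IsSplitExact ℳ ℳ' ℳ'' φ ψ ρ σ)
    {f : BimoduleCochain K A M' n} (hf : f ∈ gradedBimoduleCochain 𝒜 ℳ' r n)
    (hψf : ψ.compMultilinearMap f = 0) :
    ρ.compMultilinearMap f ∈ gradedBimoduleCochain 𝒜 ℳ r n :=
  fun p a ha => h.retraction_mem (hf p a ha) (DFunLike.congr_fun hψf a)

variable [GradedAlgebra 𝒜]
  [Module A M'] [Module Aᵐᵒᵖ M'] [SMulCommClass A Aᵐᵒᵖ M'] [IsScalarTower K A M']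
  [IsScalarTower K Aᵐᵒᵖ M'] [Module A M''] [Module Aᵐᵒᵖ M''] [SMulCommClass A Aᵐᵒᵖ M'']
  [IsScalarTower K A M''] [IsScalarTower K Aᵐᵒᵖ M''] [IsGradedBimodule 𝒜 ℳ'']

theorem IsSplitExact.comp_retraction_mem_of_exactAt_zero (h : IsSplitExact ℳ ℳ' ℳ'' φ ψ ρ σ)
    (hψ : IsGradedBimoduleMap 𝒜 ℳ' ℳ'' ψ) (hex : (bimoduleComplex 𝒜 ℳ'' r).ExactAt 0)
    {f : BimoduleCochain K A M' 0} (hf : f ∈ gradedBimoduleCochain 𝒜 ℳ' r 0)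
    (hd : bimoduleDifferential K A M' 0 f = 0) :
    ρ.compMultilinearMap f ∈ gradedBimoduleCochain 𝒜 ℳ r 0 := by
  refine h.comp_retraction_mem hf ((bimoduleComplex_exactAt_zero_iff 𝒜 ℳ'' r).1 hex _
    (fun p a ha => hψ.map_mem (hf p a ha)) ?_)
  rw [hψ.bimoduleDifferential_comp hf, hd]
  exact MultilinearMap.ext fun _ => map_zero ψ

variable [IsGradedBimodule 𝒜 ℳ']

theorem IsSplitExact.exists_comp_retraction_sub_mem_of_exactAt_succ
    (h : IsSplitExact ℳ ℳ' ℳ'' φ ψ ρ σ) (hψ : IsGradedBimoduleMap 𝒜 ℳ' ℳ'' ψ)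
    (hex : (bimoduleComplex 𝒜 ℳ'' r).ExactAt (n + 1)) {f : BimoduleCochain K A M' (n + 1)}
    (hf : f ∈ gradedBimoduleCochain 𝒜 ℳ' r (n + 1))
    (hd : bimoduleDifferential K A M' (n + 1) f = 0) :
    ∃ g ∈ gradedBimoduleCochain 𝒜 ℳ' r n,
      ρ.compMultilinearMap (f - bimoduleDifferential K A M' n g) ∈
        gradedBimoduleCochain 𝒜 ℳ r (n + 1) := by
  obtain ⟨g, hg, hgf⟩ := (bimoduleComplex_exactAt_succ_iff 𝒜 ℳ'' r n).1 hex
    (ψ.compMultilinearMap f) (fun p a ha => hψ.map_mem (hf p a ha)) (by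
      rw [hψ.bimoduleDifferential_comp hf, hd]
      exact MultilinearMap.ext fun _ => map_zero ψ)
  have hσg : σ.compMultilinearMap g ∈ gradedBimoduleCochain 𝒜 ℳ' r n :=
    fun p a ha => h.section_mem (hg p a ha)
  have hψσg : ψ.compMultilinearMap (σ.compMultilinearMap g) = g :=
    multilinearMap_ext_homogeneous 𝒜 fun p a ha => h.apply_section (hg p a ha)
  refine ⟨_, hσg, h.comp_retraction_mem (sub_mem hf (bimoduleDifferential_mem 𝒜 ℳ' hσg)) ?_⟩
  have hψd := hψ.bimoduleDifferential_comp hσg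
  rw [hψσg, hgf] at hψd
  ext a
  have := DFunLike.congr_fun hψd a
  simp only [LinearMap.compMultilinearMap_apply] at this
  simp [this]

end SplitExactStep

section Concentrated

variable {K : Type v} {A : Type u} [Field K] [Ring A] [Algebra K A] {𝒜 : ℕ → Submodule K A}
  {N : Type u} [AddCommGroup N] [Module K N]

variable (K N) in
/-- The grading of `N` for which all elements have degree `m`. -/
def concentrated {ι : Type*} [DecidableEq ι] (m j : ι) : Submodule K N :=
  if j = m then ⊤ else ⊥

@[simp]
theorem concentrated_self {ι : Type*} [DecidableEq ι] (m : ι) : concentrated K N m m = ⊤ :=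
  if_pos rfl

theorem concentrated_of_ne {ι : Type*} [DecidableEq ι] {m j : ι} (h : j ≠ m) :
    concentrated K N m j = ⊥ :=
  if_neg h

theorem finrank_concentrated {ι : Type*} [DecidableEq ι] (m j : ι) :
    Module.finrank K (concentrated K N m j) = if j = m then Module.finrank K N else 0 := by
  split_ifs with h
  · rw [h, concentrated_self, finrank_top]
  · rw [concentrated_of_ne h, finrank_bot]

variable [Module A N]

variable (𝒜 N) in
/-- The elements of `A` of positive degree annihilate `N`. -/
class IsTrivialAction : Prop where
  smul_eq_zero : ∀ {p : ℕ}, p ≠ 0 → ∀ {a : A}, a ∈ 𝒜 p → ∀ x : N, a • x = 0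

variable [IsTrivialAction 𝒜 N]

instance : SetLike.GradedSMul 𝒜 (concentrated K N (0 : ℕ)) where
  smul_mem {p q a x} ha hx := by
    by_cases hp : p = 0
    · subst hp
      by_cases hq : q = 0
      · simp [hq]
      · obtain rfl : x = 0 := by simpa [concentrated_of_ne hq] using hx
        simp
    · simp [IsTrivialAction.smul_eq_zero hp ha]

instance (m : ℤ) : IsGradedLeftModule 𝒜 (concentrated K N m) where
  smul_mem {p j a x} ha hx := by
    by_cases hp : p = 0
    · subst hp
      by_cases hj : j = m
      · simp [hj]
      · obtain rfl : x = 0 := by simpa [concentrated_of_ne hj] using hx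
        simp
    · simp [IsTrivialAction.smul_eq_zero hp ha]

open TensorProduct in
instance [IsScalarTower K A N] (V : Type u) [AddCommGroup V] [Module K V] :
    IsTrivialAction 𝒜 (N ⊗[K] V) where
  smul_eq_zero hp a ha w := by
    induction w with
    | zero => simp
    | tmul t v => rw [smul_tmul', IsTrivialAction.smul_eq_zero hp ha, zero_tmul]
    | add w w' h h' => rw [smul_add, h, h', add_zero]

end Concentrated

section TrivialModule

variable {K : Type v} {A : Type u} [Field K] [Ring A] [Algebra K A] {𝒜 : ℕ → Submodule K A}

theorem IsConnectedGraded.exists_algebraMap_eq (h𝒜 : IsConnectedGraded 𝒜) {a : A} (ha : a ∈ 𝒜 0) :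
    ∃ c : K, algebraMap K A c = a :=
  Submodule.mem_one.1 (h𝒜.2 ▸ ha)

variable [GradedAlgebra 𝒜]

instance : IsTrivialAction 𝒜 (TrivialModule 𝒜) where
  smul_eq_zero {p} hp a ha t := by
    obtain ⟨b, rfl⟩ := Submodule.Quotient.mk_surjective _ t
    rw [← Submodule.Quotient.mk_smul, Submodule.Quotient.mk_eq_zero]
    exact DirectSum.coe_decompose_mul_of_left_mem_of_not_le 𝒜 ha (by lia)

/-- The identification of the base field with the trivial module of a connected algebra. -/
def IsConnectedGraded.trivialModuleEquiv (h𝒜 : IsConnectedGraded 𝒜) : K ≃ₗ[K] TrivialModule 𝒜 :=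
  LinearEquiv.ofBijective (LinearMap.toSpanSingleton K _ (Submodule.Quotient.mk 1)) <| by
    have := h𝒜.1
    constructor
    · rw [← LinearMap.ker_eq_bot, LinearMap.ker_eq_bot']
      intro c hc
      rw [LinearMap.toSpanSingleton_apply, ← Submodule.Quotient.mk_smul,
        Submodule.Quotient.mk_eq_zero, ← Algebra.algebraMap_eq_smul_one] at hc
      have h0 : (DirectSum.decompose 𝒜 (algebraMap K A c) 0 : A) = 0 := hc
      rwa [DirectSum.decompose_of_mem_same 𝒜 (SetLike.algebraMap_mem_graded 𝒜 c),
        map_eq_zero] at h0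
    · intro t
      obtain ⟨a, rfl⟩ := Submodule.Quotient.mk_surjective _ t
      obtain ⟨c, hc⟩ := h𝒜.exists_algebraMap_eq (SetLike.coe_mem (DirectSum.decompose 𝒜 a 0))
      refine ⟨c, ?_⟩
      rw [LinearMap.toSpanSingleton_apply, ← Submodule.Quotient.mk_smul,
        ← Algebra.algebraMap_eq_smul_one, hc, Submodule.Quotient.eq]
      change (DirectSum.decompose 𝒜 (_ - a) 0 : A) = 0
      simp [DirectSum.decompose_sub]

end TrivialModule

section Truncation

open TensorProduct

variable {K : Type v} {A : Type u} [Field K] [Ring A] [Algebra K A] (𝒜 : ℕ → Submodule K A)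

/-- The grading of the ideal `A_{≥ m}`. -/
def truncation (m : ℕ) (j : ℤ) : Submodule K A :=
  if m ≤ j then intComponent 𝒜 j else ⊥

variable {𝒜}

theorem truncation_of_le {m : ℕ} {j : ℤ} (h : m ≤ j) : truncation 𝒜 m j = intComponent 𝒜 j :=
  if_pos h

theorem truncation_of_lt {m : ℕ} {j : ℤ} (h : j < m) : truncation 𝒜 m j = ⊥ :=
  if_neg (by lia)

theorem truncation_zero (j : ℤ) : truncation 𝒜 0 j = intComponent 𝒜 j := by
  cases j with
  | ofNat j => exact truncation_of_le (by simp)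
  | negSucc j => exact truncation_of_lt (by lia)

theorem truncation_antitone : Antitone (truncation 𝒜) := by
  intro m m' h j
  by_cases hj : (m' : ℤ) ≤ j
  · rw [truncation_of_le hj, truncation_of_le (by lia)]
  · simp [truncation_of_lt (not_le.1 hj)]

theorem eventually_truncation_eq_bot (m : ℕ) (j : ℤ) :
    ∀ᶠ k in Filter.atTop, truncation 𝒜 (m + k) j = ⊥ := by
  filter_upwards [Filter.eventually_gt_atTop j.toNat] with k hk
  exact truncation_of_lt (by lia)

theorem truncation_eq_of_ne {m : ℕ} {j : ℤ} (h : j ≠ m) :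
    truncation 𝒜 m j = truncation 𝒜 (m + 1) j := by
  rcases lt_or_gt_of_ne h with h | h
  · rw [truncation_of_lt h, truncation_of_lt (by lia)]
  · rw [truncation_of_le h.le, truncation_of_le (by lia)]

theorem finrank_truncation (m : ℕ) (j : ℤ) : Module.finrank K (truncation 𝒜 m j) =
    Module.finrank K (truncation 𝒜 (m + 1) j) + if j = m then Module.finrank K (𝒜 m) else 0 := by
  split_ifs with h
  · subst h
    rw [truncation_of_le le_rfl, truncation_of_lt (by simp), finrank_bot, zero_add]
    rfl
  · rw [truncation_eq_of_ne h, add_zero]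

variable [GradedAlgebra 𝒜]

instance (m : ℕ) : IsGradedBimodule 𝒜 (truncation 𝒜 m) where
  smul_mem {p j a x} ha hx := by
    by_cases hj : m ≤ j
    · rw [truncation_of_le hj] at hx
      rw [truncation_of_le (by lia)]
      exact mul_mem_intComponent_left 𝒜 ha hx
    · obtain rfl : x = 0 := by simpa [truncation_of_lt (not_le.1 hj)] using hx
      simp
  op_smul_mem {p j a x} ha hx := by
    by_cases hj : m ≤ j
    · rw [truncation_of_le hj] at hx
      rw [truncation_of_le (by lia)]
      exact mul_mem_intComponent_right 𝒜 ha hx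
    · obtain rfl : x = 0 := by simpa [truncation_of_lt (not_le.1 hj)] using hx
      simp

theorem mul_mem_truncation_succ {m p : ℕ} {j : ℤ} (hp : p ≠ 0) {a x : A} (ha : a ∈ 𝒜 p)
    (hx : x ∈ truncation 𝒜 m j) :
    a * x ∈ truncation 𝒜 (m + 1) (p + j) ∧ x * a ∈ truncation 𝒜 (m + 1) (j + p) := by
  by_cases hj : m ≤ j
  · rw [truncation_of_le (by lia), truncation_of_le (by lia)]
    rw [truncation_of_le hj] at hx
    exact ⟨mul_mem_intComponent_left 𝒜 ha hx, mul_mem_intComponent_right 𝒜 ha hx⟩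
  · obtain rfl : x = 0 := by simpa [truncation_of_lt (not_le.1 hj)] using hx
    simp

theorem decompose_eq_zero_of_mem_truncation {m : ℕ} {j : ℤ} (h : j ≠ m) {x : A}
    (hx : x ∈ truncation 𝒜 m j) : DirectSum.decompose 𝒜 x m = 0 := by
  rcases lt_or_ge j m with hj | hj
  · obtain rfl : x = 0 := by simpa [truncation_of_lt hj] using hx
    exact DirectSum.decompose_zero 𝒜 ▸ rfl
  · lift j to ℕ using by lia
    rw [truncation_of_le hj] at hx
    exact Subtype.ext (DirectSum.decompose_of_mem_ne 𝒜 hx (by exact_mod_cast h))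

theorem decompose_eq_zero_of_mem_truncation_succ {m : ℕ} {j : ℤ} {x : A}
    (hx : x ∈ truncation 𝒜 (m + 1) j) : DirectSum.decompose 𝒜 x m = 0 := by
  by_cases h : j = m
  · rw [truncation_of_lt (by lia), Submodule.mem_bot] at hx
    subst hx
    exact DirectSum.decompose_zero 𝒜 ▸ rfl
  · exact decompose_eq_zero_of_mem_truncation h (truncation_antitone m.le_succ j hx)

variable (N : Type u) [AddCommGroup N] [Module K N]

variable (𝒜) in
/-- The quotient map of `A_{≥ m}` onto its component of degree `m`. The latter is realised as
`Hom_K(N, N ⊗ A_m)` for a one-dimensional trivial module `N`, so that the cohomology with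
coefficients in it is computed by a resolution of `N`. -/
def leadingForm (m : ℕ) : A →ₗ[K] N →ₗ[K] N ⊗[K] 𝒜 m :=
  (TensorProduct.mk K N (𝒜 m)).flip ∘ₗ
    DirectSum.component K ℕ (fun i => 𝒜 i) m ∘ₗ (DirectSum.decomposeLinearEquiv 𝒜).toLinearMap

theorem leadingForm_apply (m : ℕ) (x : A) (t : N) :
    leadingForm 𝒜 N m x t = t ⊗ₜ DirectSum.decompose 𝒜 x m :=
  rfl

variable {N} in
theorem leadingForm_eq_zero {m : ℕ} {x : A} (h : DirectSum.decompose 𝒜 x m = 0) :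
    leadingForm 𝒜 N m x = 0 :=
  LinearMap.ext fun t => by rw [leadingForm_apply, h, tmul_zero]; rfl

theorem leadingForm_isGradedBimoduleMap [Module A N] [IsScalarTower K A N] [IsTrivialAction 𝒜 N]
    (h𝒜 : IsConnectedGraded 𝒜) (m : ℕ) :
    IsGradedBimoduleMap 𝒜 (truncation 𝒜 m)
      (homComponent (concentrated K N 0) (concentrated K (N ⊗[K] 𝒜 m) (m : ℤ)))
      (leadingForm 𝒜 N m) where
  map_mem {j x} hx q t ht := by
    by_cases hq : q = 0
    · by_cases hj : j = m
      · simp [hq, hj]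
      · simp [leadingForm_eq_zero (decompose_eq_zero_of_mem_truncation hj hx)]
    · obtain rfl : t = 0 := by simpa [concentrated_of_ne hq] using ht
      simp
  map_smul {p j a x} ha hx := by
    by_cases hp : p = 0
    · subst hp
      obtain ⟨c, rfl⟩ := h𝒜.exists_algebraMap_eq ha
      rw [algebraMap_smul, algebraMap_smul, map_smul]
    · rw [smul_eq_mul, leadingForm_eq_zero
        (decompose_eq_zero_of_mem_truncation_succ (mul_mem_truncation_succ hp ha hx).1)]
      ext t
      exact (IsTrivialAction.smul_eq_zero hp ha (leadingForm 𝒜 N m x t)).symm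
  map_op_smul {p j a x} ha hx := by
    ext t
    change leadingForm 𝒜 N m (x * a) t = leadingForm 𝒜 N m x (a • t)
    by_cases hp : p = 0
    · subst hp
      obtain ⟨c, rfl⟩ := h𝒜.exists_algebraMap_eq ha
      rw [← Algebra.commutes, ← Algebra.smul_def, map_smul, algebraMap_smul, map_smul]
      rfl
    · rw [IsTrivialAction.smul_eq_zero hp ha, map_zero, leadingForm_eq_zero
        (decompose_eq_zero_of_mem_truncation_succ (mul_mem_truncation_succ hp ha hx).2)]
      rfl

variable {N} (u : K ≃ₗ[K] N) (m : ℕ)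

variable (𝒜) in
/-- The section of `leadingForm` determined by an identification of the base field with `N`. -/
def leadingFormSection : (N →ₗ[K] N ⊗[K] 𝒜 m) →ₗ[K] A :=
  (𝒜 m).subtype ∘ₗ (TensorProduct.lid K (𝒜 m)).toLinearMap ∘ₗ
    u.symm.toLinearMap.rTensor (𝒜 m) ∘ₗ LinearMap.applyₗ (u 1)

theorem leadingFormSection_leadingForm {x : A} (hx : x ∈ 𝒜 m) :
    leadingFormSection 𝒜 u m (leadingForm 𝒜 N m x) = x := by
  simp [leadingFormSection, leadingForm_apply, DirectSum.decompose_of_mem_same 𝒜 hx]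

theorem leadingForm_leadingFormSection (φ : N →ₗ[K] N ⊗[K] 𝒜 m) :
    leadingForm 𝒜 N m (leadingFormSection 𝒜 u m φ) = φ := by
  have hu (t : N) : t = u.symm t • u 1 := by simp [← map_smul]
  have htmul (w : N ⊗[K] 𝒜 m) :
      u 1 ⊗ₜ[K] TensorProduct.lid K (𝒜 m) (u.symm.toLinearMap.rTensor (𝒜 m) w) = w := by
    induction w with
    | zero => simp
    | tmul t x => rw [LinearMap.rTensor_tmul, lid_tmul, ← smul_tmul, LinearEquiv.coe_coe, ← hu t]
    | add w w' h h' => rw [map_add, map_add, tmul_add, h, h']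
  ext t
  rw [hu t, map_smul, map_smul]
  congr 1
  rw [leadingForm_apply]
  simpa [leadingFormSection, DirectSum.decompose_coe] using htmul (φ (u 1))

theorem isSplitExact_leadingForm :
    IsSplitExact (truncation 𝒜 (m + 1)) (truncation 𝒜 m)
      (homComponent (concentrated K N 0) (concentrated K (N ⊗[K] 𝒜 m) (m : ℤ)))
      LinearMap.id (leadingForm 𝒜 N m) LinearMap.id (leadingFormSection 𝒜 u m) where
  comp_eq_zero hx := leadingForm_eq_zero (decompose_eq_zero_of_mem_truncation_succ hx)
  retraction_apply _ := rfl
  retraction_mem {j x} hx hψ := by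
    by_cases h : j = m
    · subst h
      rw [truncation_of_le le_rfl] at hx
      rw [← leadingFormSection_leadingForm u m hx, hψ, map_zero]
      exact zero_mem _
    · rwa [LinearMap.id_apply, ← truncation_eq_of_ne h]
  apply_retraction _ _ := rfl
  section_mem {j φ} hφ := by
    by_cases h : j = m
    · subst h
      have hmem : leadingFormSection 𝒜 u m φ ∈ 𝒜 m := SetLike.coe_mem _
      rwa [truncation_of_le le_rfl]
    · have h0 := hφ 0 (u 1) (by simp)
      rw [concentrated_of_ne (by simpa using h), Submodule.mem_bot] at h0
      simp [leadingFormSection, h0]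
  apply_section _ := leadingForm_leadingFormSection u m _

end Truncation

section EulerCharacteristicFormula

open TensorProduct

variable {K : Type v} {A : Type u} [Field K] [Ring A] [Algebra K A] {𝒜 : ℕ → Submodule K A}
  [GradedAlgebra 𝒜] {N : Type u} [AddCommGroup N] [Module K N] [Module A N] [IsScalarTower K A N]
  [IsTrivialAction 𝒜 N] (R : LinearResolution 𝒜 (concentrated K N 0) 0) {d : ℕ} {r : ℤ}

namespace LinearResolution

section Coefficients

variable (W : Type u) [AddCommGroup W] [Module K W] [Module A W] [IsScalarTower K A W]
  [IsTrivialAction 𝒜 W] (m : ℤ)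

theorem nonempty_homology_equiv_concentrated (n : ℕ) : Nonempty
    ((bimoduleComplex 𝒜 (homComponent (concentrated K N 0) (concentrated K W m)) r).homology n ≃ₗ[K]
      (R.ι n → concentrated K W m (n + r))) := by
  have h := R.nonempty_homology_equiv (𝒲 := concentrated K W m) (fun _ => concentrated_of_ne) r n
  rwa [zero_add] at h

theorem exactAt_concentrated (h : ∀ n : ℕ, n + r = m → IsEmpty (R.ι n)) (n : ℕ) :
    (bimoduleComplex 𝒜 (homComponent (concentrated K N 0) (concentrated K W m)) r).ExactAt n := by
  obtain ⟨e⟩ := R.nonempty_homology_equiv_concentrated (r := r) W m n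
  rw [HomologicalComplex.exactAt_iff_isZero_homology, ModuleCat.isZero_iff_subsingleton]
  refine e.subsingleton_congr.2 ?_
  by_cases hn : n + r = m
  · have := h n hn
    infer_instance
  · rw [concentrated_of_ne hn]
    infer_instance

theorem hasEulerChar_concentrated [∀ n, Finite (R.ι n)] (hd : ∀ n, d < n → IsEmpty (R.ι n))
    [Module.Finite K W] :
    HasEulerChar (bimoduleComplex 𝒜 (homComponent (concentrated K N 0) (concentrated K W m)) r) d
      (∑ n ∈ Finset.range (d + 1), (-1) ^ n *
        (Nat.card (R.ι n) * Module.finrank K (concentrated K W m (n + r)))) where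
  finite n := by
    obtain ⟨e⟩ := R.nonempty_homology_equiv_concentrated (r := r) W m n
    exact Module.Finite.equiv e.symm
  subsingleton n hn := by
    obtain ⟨e⟩ := R.nonempty_homology_equiv_concentrated (r := r) W m n
    have := hd n hn
    exact e.subsingleton
  sum_eq := by
    refine Finset.sum_congr rfl fun n _ => ?_
    obtain ⟨e⟩ := R.nonempty_homology_equiv_concentrated (r := r) W m n
    have := Fintype.ofFinite (R.ι n)
    rw [e.finrank_eq, Module.finrank_pi_fintype]
    simp

end Coefficients

variable (h𝒜 : IsConnectedGraded 𝒜) (u : K ≃ₗ[K] N) (hd : ∀ n, d < n → IsEmpty (R.ι n))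
include h𝒜 u hd

theorem exactAt_truncation {m : ℕ} (hm : d + r < m) (n : ℕ) :
    (bimoduleComplex 𝒜 (truncation 𝒜 m) r).ExactAt n := by
  have hgr (k n : ℕ) : (bimoduleComplex 𝒜 (homComponent (concentrated K N 0)
      (concentrated K (N ⊗[K] 𝒜 (m + k)) ((m + k : ℕ) : ℤ))) r).ExactAt n :=
    R.exactAt_concentrated _ _ (fun n hn => hd n (by lia)) n
  have hψ (k : ℕ) := leadingForm_isGradedBimoduleMap N h𝒜 (m + k)
  have hsplit (k : ℕ) := isSplitExact_leadingForm (𝒜 := 𝒜) u (m + k)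
  cases n with
  | zero =>
    exact (bimoduleComplex_exactAt_zero_iff 𝒜 _ r).2 fun f hf hdf =>
      eq_zero_of_bimoduleDifferential_eq_zero_of_filtration (eventually_truncation_eq_bot m)
        (fun k f hf hdf => (hsplit k).comp_retraction_mem_of_exactAt_zero (hψ k) (hgr k 0) hf hdf)
        hf hdf
  | succ n =>
    exact (bimoduleComplex_exactAt_succ_iff 𝒜 _ r n).2 fun f hf hdf =>
      exists_bimoduleDifferential_eq_of_filtration
        (fun k l hkl => truncation_antitone (Nat.add_le_add_left hkl m))
        (eventually_truncation_eq_bot m)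
        (fun k f hf hdf =>
          (hsplit k).exists_comp_retraction_sub_mem_of_exactAt_succ (hψ k) (hgr k _) hf hdf)
        hf hdf

theorem hasEulerChar_truncation [∀ n, Finite (R.ι n)] [∀ m, Module.Finite K (𝒜 m)] (m : ℕ) :
    HasEulerChar (bimoduleComplex 𝒜 (truncation 𝒜 m) r) d
      (∑ n ∈ Finset.range (d + 1), (-1) ^ n *
        (Nat.card (R.ι n) * Module.finrank K (truncation 𝒜 m (n + r)))) := by
  obtain ⟨k, hk⟩ : ∃ k : ℕ, d + r < m + k := ⟨(d + r + 1).toNat, by lia⟩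
  induction k generalizing m with
  | zero =>
    have hm : d + r < m := by simpa using hk
    convert HasEulerChar.of_exactAt (R.exactAt_truncation h𝒜 u hd hm) d using 1
    refine Finset.sum_eq_zero fun n hn => ?_
    rw [Finset.mem_range] at hn
    rw [truncation_of_lt (by lia), finrank_bot, Nat.cast_zero, mul_zero, mul_zero]
  | succ k ih =>
    let θ : 𝒜 m ≃ₗ[K] N ⊗[K] 𝒜 m := (TensorProduct.lid K (𝒜 m)).symm ≪≫ₗ u.rTensor (𝒜 m)
    have := Module.Finite.equiv θ
    have hφ : IsGradedBimoduleMap 𝒜 (truncation 𝒜 (m + 1)) (truncation 𝒜 m) LinearMap.id :=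
      { map_mem := fun hx => truncation_antitone m.le_succ _ hx
        map_smul := fun _ _ => rfl
        map_op_smul := fun _ _ => rfl }
    convert (ih (m + 1) (by lia)).of_shortExact
      ((isSplitExact_leadingForm u m).shortExact hφ (leadingForm_isGradedBimoduleMap N h𝒜 m) r)
      (R.hasEulerChar_concentrated (r := r) (N ⊗[K] 𝒜 m) m hd) using 1
    rw [← Finset.sum_add_distrib]
    refine Finset.sum_congr rfl fun n _ => ?_
    rw [finrank_truncation, finrank_concentrated, θ.finrank_eq]
    push_cast
    ring

end LinearResolution

end EulerCharacteristicFormula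

section HochschildCohomology

variable {K : Type v} {A : Type u} [Field K] [Ring A] [Algebra K A] {𝒜 : ℕ → Submodule K A}

theorem gradedBimoduleCochain_truncation_zero (r : ℤ) (n : ℕ) :
    gradedBimoduleCochain 𝒜 (truncation 𝒜 0) r n = gradedCochain 𝒜 r n := by
  rw [show truncation 𝒜 0 = intComponent 𝒜 from funext truncation_zero]
  rfl

variable [GradedAlgebra 𝒜]

theorem hochschildComplex_d (r : ℤ) (n : ℕ) :
    (hochschildComplex 𝒜 r).d n (n + 1) = ModuleCat.ofHom
      ((differential K A n).restrict (differential_mem_gradedCochain 𝒜 r n)) :=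
  CochainComplex.of_d (fun n => ModuleCat.of K (gradedCochain 𝒜 r n))
    (fun n => ModuleCat.ofHom
      ((differential K A n).restrict (differential_mem_gradedCochain 𝒜 r n))) n

variable (𝒜) in
/-- The Hochschild complex is the complex of cochains with values in `A_{≥ 0}`. -/
def hochschildComplexIso (r : ℤ) :
    hochschildComplex 𝒜 r ≅ bimoduleComplex 𝒜 (truncation 𝒜 0) r :=
  HomologicalComplex.Hom.isoOfComponents
    (fun n => (LinearEquiv.ofEq _ _ (gradedBimoduleCochain_truncation_zero r n).symm).toModuleIso)
    (by
      rintro n _ rfl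
      rw [hochschildComplex_d, bimoduleComplex_d]
      ext f : 2
      exact Subtype.ext (bimoduleDifferential_self f.1))

theorem subsingleton_HH_of_neg {i : ℤ} (hi : i < 0) (r : ℤ) : Subsingleton (HH 𝒜 i r) :=
  ModuleCat.isZero_iff_subsingleton.1 (HomologicalComplex.extend_exactAt _ _ _ fun n hn => by
    have : (n : ℤ) = i := hn
    lia).isZero_homology

variable (𝒜) in
theorem nonempty_HH_equiv (n : ℕ) (r : ℤ) :
    Nonempty (HH 𝒜 n r ≃ₗ[K] (bimoduleComplex 𝒜 (truncation 𝒜 0) r).homology n) :=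
  ⟨((HomologicalComplex.extendHomologyIso (hochschildComplex 𝒜 r) ComplexShape.embeddingUpNat
    (j := n) (j' := (n : ℤ)) rfl) ≪≫
      HomologicalComplex.homologyMapIso (hochschildComplexIso 𝒜 r) n).toLinearEquiv⟩

end HochschildCohomology

section GradedProjective

variable {K : Type v} {A : Type u} [Field K] [Ring A] [Algebra K A] {𝒜 : ℕ → Submodule K A}
  [GradedAlgebra 𝒜] {P : Type u} [AddCommGroup P] [Module K P] [Module A P] [IsScalarTower K A P]
  {ℱ : ℕ → Submodule K P} [DirectSum.Decomposition ℱ] [SetLike.GradedSMul 𝒜 ℱ] {s : ℕ}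

section

variable {ι : Type*} {b : ι → P} (h𝒜 : IsConnectedGraded 𝒜) (hb : ∀ i, b i ∈ ℱ s)
  (hli : LinearIndependent K b)
include h𝒜 hb hli

theorem decompose_zero_eq_zero_of_linearCombination_eq_zero {x : ι →₀ A}
    (hx : Finsupp.linearCombination A b x = 0) (i : ι) : DirectSum.decompose 𝒜 (x i) 0 = 0 := by
  choose c hc using fun j => h𝒜.exists_algebraMap_eq (DirectSum.decompose 𝒜 (x j) 0).2
  have hsum : ∑ j ∈ x.support, c j • b j = 0 := by
    have h := congrArg (fun y => (DirectSum.decompose ℱ y (0 + s) : P)) hx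
    simp only [Finsupp.linearCombination_apply, Finsupp.sum, DirectSum.decompose_sum,
      DirectSum.sum_apply, AddSubmonoidClass.coe_finsetSum, decompose_smul_of_mem 𝒜 ℱ (hb _),
      ← hc, algebraMap_smul] at h
    simpa using h
  by_cases hi : i ∈ x.support
  · rw [← ZeroMemClass.coe_eq_zero, ← hc, linearIndependent_iff'.1 hli _ _ hsum i hi, map_zero]
  · rw [Finsupp.notMem_support_iff.1 hi, DirectSum.decompose_zero]
    rfl

/-- The kernel of the free cover of `P` by the `b i` is a direct summand whose elements have
coordinates in `A_{≥ 1}`, so that the coordinates lie in `A_{≥ k}` for all `k`. -/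
theorem linearIndependent_of_projective [Module.Projective A P]
    (hspan : Submodule.span A (Set.range b) = ⊤) : LinearIndependent A b := by
  let φ := Finsupp.linearCombination A b
  obtain ⟨σ, hσ⟩ := Module.projective_lifting_property φ LinearMap.id
    (LinearMap.range_eq_top.1 (by rw [Finsupp.range_linearCombination, hspan]))
  let e := LinearMap.id - σ ∘ₗ φ
  have hφe (y : ι →₀ A) : φ (e y) = 0 := by
    change φ (y - σ (φ y)) = 0
    rw [map_sub, show φ (σ (φ y)) = φ y from LinearMap.congr_fun hσ (φ y), sub_self]
  have hcoord {x : ι →₀ A} (hx : φ x = 0) (i : ι) :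
      x i = ∑ j ∈ x.support, x j * e (Finsupp.single j 1) i := by
    have hex : e x = x := by simp [e, hx]
    conv_lhs => rw [← hex, ← Finsupp.sum_single x]
    simp only [Finsupp.sum, map_sum, Finsupp.finsetSum_apply]
    refine Finset.sum_congr rfl fun j _ => ?_
    rw [← smul_eq_mul, ← Finsupp.smul_apply, ← map_smul, Finsupp.smul_single, smul_eq_mul, mul_one]
  have hzero (k : ℕ) : ∀ x, φ x = 0 → ∀ i, DirectSum.decompose 𝒜 (x i) k = 0 := by
    induction k using Nat.strong_induction_on with
    | _ k ih =>
      intro x hx i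
      rw [hcoord hx i, DirectSum.decompose_sum, DirectSum.sum_apply]
      refine Finset.sum_eq_zero fun j _ => ?_
      rw [← ZeroMemClass.coe_eq_zero, DirectSum.decompose_mul,
        DirectSum.coe_mul_apply_eq_sum_antidiagonal]
      refine Finset.sum_eq_zero fun ⟨p, q⟩ hpq => ?_
      have hk : p + q = k := Finset.HasAntidiagonal.mem_antidiagonal.1 hpq
      rcases p.eq_zero_or_pos with rfl | hp
      · rw [decompose_zero_eq_zero_of_linearCombination_eq_zero h𝒜 hb hli hx]
        simp
      · rw [ih q (by lia) _ (hφe _)]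
        simp
  refine (injective_iff_map_eq_zero φ).2 fun x hx => Finsupp.ext fun i =>
    (DirectSum.decompose 𝒜).injective ?_
  rw [Finsupp.zero_apply, DirectSum.decompose_zero]
  exact DFinsupp.ext fun k => hzero k x hx i

end

theorem exists_basis_of_projective (h𝒜 : IsConnectedGraded 𝒜) [Module.Projective A P]
    (hspan : Submodule.span A (ℱ s : Set P) = ⊤) :
    ∃ (ι : Type u) (b : Module.Basis ι A P), ∀ i, b i ∈ ℱ s := by
  let β := Module.Basis.ofVectorSpace K (ℱ s)
  have hli : LinearIndependent K fun i => (β i : P) :=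
    β.linearIndependent.map' (ℱ s).subtype (Submodule.ker_subtype _)
  have hle : ℱ s ≤ (Submodule.span A (Set.range fun i => (β i : P))).restrictScalars K := by
    have hK : Submodule.span K (Set.range fun i => (β i : P)) = ℱ s := by
      rw [Set.range_comp' _ β, ← Submodule.coe_subtype, ← Submodule.map_span, β.span_eq,
        Submodule.map_top, Submodule.range_subtype]
    exact hK.ge.trans (Submodule.span_le_restrictScalars K A _)
  have hβ : Submodule.span A (Set.range fun i => (β i : P)) = ⊤ :=
    top_le_iff.1 (hspan ▸ Submodule.span_le.2 hle)
  have hA := linearIndependent_of_projective h𝒜 (fun i => (β i).2) hli hβ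
  exact ⟨_, Module.Basis.mk hA hβ.ge, fun i => by
    rw [Module.Basis.mk_apply]
    exact (β i).2⟩

end GradedProjective

section MapToConcentrated

variable {K : Type v} [Field K] {ι F N : Type*} [DecidableEq ι] [AddCommGroup F] [Module K F]
  [AddCommGroup N] {ℱ : ι → Submodule K F} {G : Type*} [FunLike G F N] {ε : G} {s : ι}

theorem map_decompose_eq_of_forall_ne [AddMonoidHomClass G F N] [DirectSum.Decomposition ℱ]
    (hε : ∀ q ≠ s, ∀ x ∈ ℱ q, ε x = 0) (x : F) : ε (DirectSum.decompose ℱ x s) = ε x := by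
  classical
  conv_rhs => rw [← DirectSum.sum_support_decompose ℱ x, map_sum]
  refine (Finset.sum_eq_single s (fun q _ hq => hε q hq _ (SetLike.coe_mem _)) fun h => ?_).symm
  rw [DFinsupp.notMem_support_iff.1 h, ZeroMemClass.coe_zero, map_zero]

variable [Module K N]

theorem map_mem_concentrated (hε : ∀ q ≠ s, ∀ x ∈ ℱ q, ε x = 0) {q : ι} {x : F} (hx : x ∈ ℱ q) :
    ε x ∈ concentrated K N s q := by
  rcases eq_or_ne q s with rfl | hq
  · rw [concentrated_self]
    trivial
  · rw [hε q hq x hx]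
    exact zero_mem _

theorem exists_mem_map_eq_of_mem_concentrated [AddMonoidHomClass G F N]
    [DirectSum.Decomposition ℱ] (hε : ∀ q ≠ s, ∀ x ∈ ℱ q, ε x = 0)
    (hsurj : Function.Surjective ε) {q : ι} {y : N} (hy : y ∈ concentrated K N s q) :
    ∃ x ∈ ℱ q, ε x = y := by
  rcases eq_or_ne q s with rfl | hq
  · obtain ⟨x, rfl⟩ := hsurj y
    exact ⟨_, SetLike.coe_mem _, map_decompose_eq_of_forall_ne hε x⟩
  · obtain rfl : y = 0 := by rwa [concentrated_of_ne hq] at hy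
    exact ⟨0, zero_mem _, map_zero _⟩

end MapToConcentrated

section Koszul

variable {K : Type v} {A : Type u} [Field K] [Ring A] [Algebra K A] {𝒜 : ℕ → Submodule K A}
  [GradedAlgebra 𝒜]

theorem IsKoszul.nonempty_linearResolution (h𝒜 : IsConnectedGraded 𝒜) (h : IsKoszul 𝒜) :
    Nonempty (LinearResolution 𝒜 (concentrated K (TrivialModule 𝒜) 0) 0) := by
  classical
  obtain ⟨Q, -, hQ⟩ := h
  let (n : ℕ) : Module K (Q.P n) := Module.compHom (Q.P n) (algebraMap K A)
  have (n : ℕ) : IsScalarTower K A (Q.P n) := ⟨fun c a x => by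
    rw [Algebra.smul_def, mul_smul]; rfl⟩
  let component (n j : ℕ) : Submodule K (Q.P n) :=
    { Q.component n j with
      smul_mem' c x hx := by
        simpa using Q.smul_mem n 0 j _ x (SetLike.algebraMap_mem_graded 𝒜 c) hx }
  let (n : ℕ) : DirectSum.Decomposition (component n) :=
    DirectSum.IsInternal.chooseDecomposition (component n) (Q.isInternal n)
  have (n : ℕ) : SetLike.GradedSMul 𝒜 (component n) :=
    ⟨fun _ _ _ _ ha hx => Q.smul_mem n _ _ _ _ ha hx⟩
  have hbasis (n : ℕ) : ∃ (ι : Type u) (b : Module.Basis ι A (Q.P n)), ∀ i, b i ∈ component n n :=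
    have := Q.projective n
    exists_basis_of_projective h𝒜 (hQ n)
  choose ι basis hbasis using hbasis
  exact ⟨{
    P := Q.P
    component
    ι
    basis
    basis_mem n i := by simpa using hbasis n i
    d := Q.d
    d_mem := Q.d_mem
    ε := Q.ε
    ε_mem _ _ hx := map_mem_concentrated (fun _ hq _ => Q.ε_eq_zero _ _ hq) hx
    ε_surjective := Q.ε_surjective
    exists_lift _ _ hy := exists_mem_map_eq_of_mem_concentrated (ℱ := component 0)
      (fun _ hq _ => Q.ε_eq_zero _ _ hq) Q.ε_surjective hy
    exact_zero := Q.exact_zero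
    exact_succ := Q.exact_succ }⟩

end Koszul

section ExtMk

variable {C : Type*} [Category* C] [Abelian C] [HasExt.{u} C] {X Y : C}
  (Q : ProjectiveResolution X)

open CochainComplex.HomComplex in
theorem extMk_zero_eq_zero_iff (f : Q.complex.X 0 ⟶ Y) (m : ℕ) (hm : 0 + 1 = m)
    (hf : Q.complex.d m 0 ≫ f = 0) : Q.extMk f m hm hf = 0 ↔ f = 0 := by
  simp only [← Q.extEquivCohomologyClass.apply_eq_iff_eq,
    ProjectiveResolution.extEquivCohomologyClass_extMk,
    ProjectiveResolution.extEquivCohomologyClass_zero, CohomologyClass.mk_eq_zero_iff]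
  rw [Cocycle.toSingleMk_mem_coboundaries_iff _ _ _ _ _ 1 (by simp)]
  have hd : Q.cochainComplex.d (-(0 : ℕ)) 1 = 0 :=
    (Q.cochainComplex.isZero_of_isStrictlyLE 0 1).eq_of_tgt _ _
  refine ⟨fun ⟨g, hg⟩ => ?_, fun h => ⟨0, by simp [h]⟩⟩
  rw [hd, Limits.zero_comp] at hg
  rw [← cancel_epi (Q.cochainComplexXIso (-(0 : ℕ)) 0 rfl).hom, ← hg, Limits.comp_zero]

theorem extMk_smul {K : Type*} [Ring K] [Linear K C] {n m : ℕ} (hm : n + 1 = m) (c : K)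
    (f : Q.complex.X n ⟶ Y) (hf : Q.complex.d m n ≫ f = 0) :
    Q.extMk (c • f) m hm (by rw [Linear.comp_smul, hf, smul_zero]) = c • Q.extMk f m hm hf := by
  rw [Abelian.Ext.smul_eq_comp_mk₀, Q.extMk_comp_mk₀]
  congr 1
  rw [Linear.comp_smul, Category.comp_id]

end ExtMk

namespace LinearResolution

variable {K : Type v} {A : Type u} [Field K] [Ring A] [Algebra K A] {𝒜 : ℕ → Submodule K A}
  {N : Type u} [AddCommGroup N] [Module K N] [Module A N] {𝒩 : ℕ → Submodule K N} {s : ℕ}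
  (R : LinearResolution 𝒜 𝒩 s)

/-- The chain complex underlying a linear resolution. -/
def chainComplex : ChainComplex (ModuleCat.{u} A) ℕ :=
  ChainComplex.of (fun n => ModuleCat.of A (R.P n)) (fun n => ModuleCat.ofHom (R.d n)) fun n => by
    rw [← ModuleCat.ofHom_comp, (R.exact_succ n).linearMap_comp_eq_zero]
    rfl

theorem chainComplex_d (n : ℕ) : R.chainComplex.d (n + 1) n = ModuleCat.ofHom (R.d n) :=
  ChainComplex.of_d (fun n => ModuleCat.of A (R.P n)) (fun n => ModuleCat.ofHom (R.d n)) n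

theorem chainComplex_d_comp_ε :
    R.chainComplex.d 1 0 ≫ (ModuleCat.ofHom R.ε : R.chainComplex.X 0 ⟶ _) = 0 := by
  rw [show R.chainComplex.d 1 0 = _ from R.chainComplex_d 0]
  refine (ModuleCat.ofHom_comp _ _).symm.trans ?_
  rw [R.exact_zero.linearMap_comp_eq_zero]
  rfl

/-- A linear resolution as a projective resolution in the category of `A`-modules. -/
def projectiveResolution : ProjectiveResolution (ModuleCat.of A N) where
  complex := R.chainComplex
  projective n := (IsProjective.iff_projective (R.P n)).1 (.of_basis (R.basis n))
  π := (ChainComplex.toSingle₀Equiv _ _).symm ⟨ModuleCat.ofHom R.ε, R.chainComplex_d_comp_ε⟩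
  quasiIso := ⟨fun n => by
    cases n with
    | zero =>
      rw [ChainComplex.quasiIsoAt₀_iff, ShortComplex.quasiIso_iff_of_zeros']
      · have h0 : (ShortComplex.mk (ModuleCat.ofHom (R.d 0)) (ModuleCat.ofHom R.ε) (by
              rw [← ModuleCat.ofHom_comp, R.exact_zero.linearMap_comp_eq_zero]; rfl)).Exact :=
          (ShortComplex.moduleCat_exact_iff _).2 fun x hx => (R.exact_zero x).1 hx
        refine (ShortComplex.exact_and_epi_g_iff_of_iso ?_).2
          ⟨h0, (ModuleCat.epi_iff_surjective _).2 R.ε_surjective⟩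
        exact ShortComplex.isoMk (Iso.refl _) (Iso.refl _) (Iso.refl _)
          ((Category.id_comp _).trans ((R.chainComplex_d 0).symm.trans (Category.comp_id _).symm))
          ((Category.id_comp _).trans
            ((ChainComplex.toSingle₀Equiv_symm_apply_f_zero _ R.chainComplex_d_comp_ε).symm.trans
              (Category.comp_id _).symm))
      all_goals rfl
    | succ n =>
      rw [quasiIsoAt_iff_exactAt' _ _ (ChainComplex.exactAt_succ_single_obj _ _),
        HomologicalComplex.exactAt_iff' _ (n + 1 + 1) (n + 1) n (by simp) (by simp),
        ShortComplex.moduleCat_exact_iff]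
      intro (x : R.P (n + 1)) hx
      change R.chainComplex.d (n + 1) n x = 0 at hx
      rw [chainComplex_d] at hx
      obtain ⟨y, hy⟩ := (R.exact_succ n x).1 hx
      refine ⟨y, ?_⟩
      change R.chainComplex.d (n + 1 + 1) (n + 1) y = x
      rw [chainComplex_d]
      exact hy⟩

section Ext

variable (Y : Type u) [AddCommGroup Y] [Module K Y] [Module A Y] [IsScalarTower K A Y]

/-- The differential of the complex `Hom_A(P, Y)`. -/
abbrev homD (n : ℕ) : (R.P n →ₗ[A] Y) →ₗ[K] (R.P (n + 1) →ₗ[A] Y) :=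
  LinearMap.lcomp K Y (R.d n)

/-- The coboundaries of the complex `Hom_A(P, Y)`. -/
def homCoboundaries : ∀ n, Submodule K (R.P n →ₗ[A] Y)
  | 0 => ⊥
  | n + 1 => LinearMap.range (R.homD Y n)

/-- Linear maps as morphisms of the category of modules. -/
def homEquiv (n : ℕ) :
    (R.P n →ₗ[A] Y) ≃+ (R.projectiveResolution.complex.X n ⟶ ModuleCat.of A Y) where
  toFun f := ModuleCat.ofHom f
  invFun g := ModuleCat.Hom.hom (R := A) g
  map_add' _ _ := rfl
  left_inv _ := rfl
  right_inv _ := rfl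

variable {Y} in
theorem d_comp_homEquiv {n : ℕ} (f : R.P n →ₗ[A] Y) :
    R.projectiveResolution.complex.d (n + 1) n ≫ R.homEquiv Y n f =
      R.homEquiv Y (n + 1) (R.homD Y n f) :=
  (congrArg (· ≫ ModuleCat.ofHom f) (R.chainComplex_d n)).trans (ModuleCat.ofHom_comp _ _).symm

variable {Y} in
theorem d_comp_homEquiv_eq_zero_iff {n : ℕ} {f : R.P n →ₗ[A] Y} :
    R.projectiveResolution.complex.d (n + 1) n ≫ R.homEquiv Y n f = 0 ↔ R.homD Y n f = 0 := by
  rw [d_comp_homEquiv, AddEquiv.map_eq_zero_iff]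

/-- The extension class of a cocycle of `Hom_A(P, Y)`. -/
def extClass (n : ℕ) : LinearMap.ker (R.homD Y n) →ₗ[K]
    Abelian.Ext (ModuleCat.of A N) (ModuleCat.of A Y) n where
  toFun f := R.projectiveResolution.extMk (R.homEquiv Y n f.1) (n + 1) rfl
    (R.d_comp_homEquiv_eq_zero_iff.2 f.2)
  map_add' f g := by
    rw [R.projectiveResolution.add_extMk]
    congr 1
  map_smul' c f := by
    refine Eq.trans ?_ (extMk_smul R.projectiveResolution rfl c _ _)
    congr 1
    exact ModuleCat.hom_ext (LinearMap.ext fun x => (algebraMap_smul A c (f.1 x)).symm)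

theorem extClass_surjective (n : ℕ) : Function.Surjective (R.extClass Y n) := fun α => by
  obtain ⟨g, hg, rfl⟩ := R.projectiveResolution.extMk_surjective α (n + 1) rfl
  obtain ⟨f, rfl⟩ := (R.homEquiv Y n).surjective g
  exact ⟨⟨f, R.d_comp_homEquiv_eq_zero_iff.1 hg⟩, rfl⟩

variable {Y} in
theorem extClass_eq_zero_iff {n : ℕ} (f : LinearMap.ker (R.homD Y n)) :
    R.extClass Y n f = 0 ↔ f.1 ∈ R.homCoboundaries Y n := by
  cases n with
  | zero =>
    refine (extMk_zero_eq_zero_iff R.projectiveResolution (R.homEquiv Y 0 f.1) 1 rfl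
      (R.d_comp_homEquiv_eq_zero_iff.2 f.2)).trans ?_
    rw [AddEquiv.map_eq_zero_iff]
    rfl
  | succ n =>
    refine (R.projectiveResolution.extMk_eq_zero_iff (R.homEquiv Y (n + 1) f.1) (n + 2) rfl
      (R.d_comp_homEquiv_eq_zero_iff.2 f.2) n rfl).trans ?_
    rw [(R.homEquiv Y n).surjective.exists]
    refine exists_congr fun g => ?_
    rw [d_comp_homEquiv, (R.homEquiv Y (n + 1)).injective.eq_iff]

theorem ker_homD_le_homCoboundaries {n : ℕ}
    [Subsingleton (Abelian.Ext (ModuleCat.of A N) (ModuleCat.of A Y) n)] :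
    LinearMap.ker (R.homD Y n) ≤ R.homCoboundaries Y n := fun f hf =>
  (R.extClass_eq_zero_iff ⟨f, hf⟩).1 (Subsingleton.elim _ _)

end Ext

section TrivialCoefficients

variable {Y : Type u} [AddCommGroup Y] [Module K Y] [Module A Y] [IsScalarTower K A Y]
  [GradedAlgebra 𝒜] [IsTrivialAction 𝒜 Y]

theorem homD_eq_zero (n : ℕ) : R.homD Y n = 0 := by
  refine LinearMap.ext fun f => (R.basis (n + 1)).ext fun i => ?_
  have hd : R.d n (R.basis (n + 1) i) ∈ R.component n (s + (n + 1)) :=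
    R.d_mem n _ _ (R.basis_mem (n + 1) i)
  change f (R.d n (R.basis (n + 1) i)) = 0
  rw [← (R.basis n).linearCombination_repr (R.d n (R.basis (n + 1) i)),
    Finsupp.linearCombination_apply, Finsupp.sum, map_sum]
  refine Finset.sum_eq_zero fun j _ => ?_
  have hj : (R.basis n).repr (R.d n (R.basis (n + 1) i)) j ∈ 𝒜 1 := by
    have h := basis_repr_mem (𝒜 := 𝒜) (R.basis_mem n) hd j
    rwa [show ((s + (n + 1) : ℕ) - (s + n : ℕ) : ℤ) = Int.ofNat 1 by simp] at h
  rw [map_smul, IsTrivialAction.smul_eq_zero one_ne_zero hj]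

theorem isEmpty_ι_of_subsingleton_ext [Nontrivial Y] {n : ℕ}
    (h : Subsingleton (Abelian.Ext (ModuleCat.of A N) (ModuleCat.of A Y) n)) :
    IsEmpty (R.ι n) := by
  obtain ⟨y, hy⟩ := exists_ne (0 : Y)
  have hB : R.homCoboundaries Y n = ⊥ := by
    cases n with
    | zero => rfl
    | succ n => exact LinearMap.range_eq_bot.2 (R.homD_eq_zero n)
  refine ⟨fun i => hy ?_⟩
  have hf := R.ker_homD_le_homCoboundaries Y (LinearMap.congr_fun (R.homD_eq_zero n)
    ((R.basis n).constr ℕ fun _ => y))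
  rw [hB, Submodule.mem_bot] at hf
  simpa using LinearMap.congr_fun hf (R.basis n i)

end TrivialCoefficients

end LinearResolution

section HomogeneousPart

variable {K : Type v} {A : Type u} [Field K] [Ring A] [Algebra K A] (𝒜 : ℕ → Submodule K A)
  [GradedAlgebra 𝒜]

instance : IsGradedLeftModule 𝒜 (intComponent 𝒜) where
  smul_mem := mul_mem_intComponent_left 𝒜

/-- The projection of `A` onto its component of degree `j ∈ ℤ`. -/
def homogeneousPart : ℤ → A →ₗ[K] A
  | .ofNat m => GradedAlgebra.proj 𝒜 m
  | .negSucc _ => 0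

variable {𝒜} {p j k : ℤ} {c x : A}

omit [GradedAlgebra 𝒜] in
instance [∀ m, Module.Finite K (𝒜 m)] : Module.Finite K (intComponent 𝒜 j) := by
  rcases j with j | j
  · exact inferInstanceAs (Module.Finite K (𝒜 j))
  · exact inferInstanceAs (Module.Finite K (⊥ : Submodule K A))

theorem homogeneousPart_mem : homogeneousPart 𝒜 j x ∈ intComponent 𝒜 j := by
  rcases j with j | j
  · exact SetLike.coe_mem (DirectSum.decompose 𝒜 x j)
  · exact zero_mem _

theorem homogeneousPart_of_mem (hx : x ∈ intComponent 𝒜 j) : homogeneousPart 𝒜 j x = x := by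
  rcases j with j | j
  · exact DirectSum.decompose_of_mem_same 𝒜 hx
  · exact (Submodule.mem_bot K |>.1 hx).symm

theorem homogeneousPart_of_mem_ne (hx : x ∈ intComponent 𝒜 j) (hjk : j ≠ k) :
    homogeneousPart 𝒜 k x = 0 := by
  rcases k with k | k
  · rcases j with j | j
    · exact DirectSum.decompose_of_mem_ne 𝒜 hx fun h => hjk (congrArg Int.ofNat h)
    · rw [Submodule.mem_bot K |>.1 hx, map_zero]
  · rfl

theorem homogeneousPart_mul (hc : c ∈ intComponent 𝒜 p) :
    homogeneousPart 𝒜 (p + j) (c * x) = c * homogeneousPart 𝒜 j x := by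
  rcases p with p | p
  · rcases j with j | j
    · exact DirectSum.coe_decompose_mul_add_of_left_mem 𝒜 hc
    · rw [show homogeneousPart 𝒜 (.negSucc j) x = 0 from rfl, mul_zero]
      rcases h : (Int.ofNat p + Int.negSucc j) with k | k
      · exact DirectSum.coe_decompose_mul_of_left_mem_of_not_le 𝒜 hc (by lia)
      · rfl
  · rw [Submodule.mem_bot K |>.1 hc, zero_mul, zero_mul, map_zero]

variable {F : Type u} [AddCommGroup F] [Module K F] [Module A F] [IsScalarTower K A F]
  {ℱ : ℕ → Submodule K F} {ι : Type*} {b : Module.Basis ι A F} {s : ℕ}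

variable (𝒜) in
theorem exists_gradedHom_apply_eq_homogeneousPart [DirectSum.Decomposition ℱ]
    [SetLike.GradedSMul 𝒜 ℱ] (hb : ∀ i, b i ∈ ℱ s) (f : F →ₗ[A] A) (r : ℤ) :
    ∃ g ∈ gradedHom (A := A) ℱ (intComponent 𝒜) r, ∀ q, ∀ x ∈ ℱ q,
      g x = homogeneousPart 𝒜 (q + r) (f x) := by
  refine ⟨b.constr K fun i => homogeneousPart 𝒜 (s + r) (f (b i)),
    constr_mem_gradedHom 𝒜 hb fun i => homogeneousPart_mem, fun q x hx => ?_⟩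
  conv_rhs => rw [← b.linearCombination_repr x, Finsupp.linearCombination_apply, Finsupp.sum]
  rw [Module.Basis.constr_apply, Finsupp.sum, map_sum, map_sum]
  refine Finset.sum_congr rfl fun i _ => ?_
  have hi : b.repr x i ∈ intComponent 𝒜 (q - s) := basis_repr_mem hb hx i
  rw [map_smul, smul_eq_mul, smul_eq_mul, ← homogeneousPart_mul hi,
    show (q : ℤ) - s + (s + r) = q + r by ring]

theorem eq_zero_of_mem_gradedHom_of_ne (hb : ∀ i, b i ∈ ℱ s) {r r' : ℤ} (hrr' : r ≠ r')
    {f : F →ₗ[A] A} (hf : f ∈ gradedHom ℱ (intComponent 𝒜) r)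
    (hf' : f ∈ gradedHom ℱ (intComponent 𝒜) r') : f = 0 := b.ext fun i => by
  rw [← homogeneousPart_of_mem (mem_gradedHom.1 hf s (b i) (hb i)),
    homogeneousPart_of_mem_ne (mem_gradedHom.1 hf' s (b i) (hb i)) (by simpa using hrr'.symm),
    LinearMap.zero_apply]

omit [GradedAlgebra 𝒜] in
theorem gradedHom_eq_bot (hb : ∀ i, b i ∈ ℱ s) {r : ℤ} (hr : s + r < 0) :
    gradedHom (A := A) ℱ (intComponent 𝒜) r = ⊥ := by
  refine (Submodule.eq_bot_iff _).2 fun f hf => b.ext fun i => ?_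
  have h := mem_gradedHom.1 hf s (b i) (hb i)
  obtain ⟨k, hk⟩ := Int.eq_negSucc_of_lt_zero hr
  rwa [hk] at h

end HomogeneousPart

section Finite

theorem finite_of_finite_pi {K V ι : Type*} [Field K] [AddCommGroup V] [Module K V] [Nontrivial V]
    (h : Module.Finite K (ι → V)) : Finite ι := by
  classical
  obtain ⟨v, hv⟩ := exists_ne (0 : V)
  exact (Pi.linearIndependent_single_of_ne_zero fun _ => hv : LinearIndependent K _).finite

theorem finrank_map_add_finrank_inf_ker {K V W : Type*} [Field K] [AddCommGroup V] [Module K V]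
    [AddCommGroup W] [Module K W] (f : V →ₗ[K] W) (p : Submodule K V) [Module.Finite K p] :
    Module.finrank K (p.map f) + Module.finrank K (LinearMap.ker f ⊓ p : Submodule K V) =
      Module.finrank K p := by
  rw [← (f.domRestrict p).finrank_range_add_finrank_ker, LinearMap.range_domRestrict,
    LinearMap.ker_domRestrict, inf_comm, ← Submodule.map_comap_subtype,
    Submodule.finrank_map_subtype_eq]

theorem finite_of_map_le {K V W : Type*} [Field K] [AddCommGroup V] [Module K V]
    [AddCommGroup W] [Module K W] {f : V →ₗ[K] W} {p : Submodule K V} {q : Submodule K W}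
    [Module.Finite K q] (hle : p.map f ≤ q) (hker : LinearMap.ker f ⊓ p = ⊥) :
    Module.Finite K p := by
  refine Module.Finite.of_injective (f.restrict fun x hx => hle (Submodule.mem_map_of_mem hx))
    ((injective_iff_map_eq_zero _).2 fun x hx => Subtype.ext ?_)
  exact (Submodule.eq_bot_iff _).1 hker x ⟨congrArg Subtype.val hx, x.2⟩

end Finite

namespace LinearResolution

section Strand

variable {K : Type v} {A : Type u} [Field K] [Ring A] [Algebra K A] {𝒜 : ℕ → Submodule K A}
  {N : Type u} [AddCommGroup N] [Module A N] [Module K N] {𝒩 : ℕ → Submodule K N}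
  (R : LinearResolution 𝒜 𝒩 0)

/-- The terms of the subcomplex of internal degree `r` of `Hom_A(P, A)`. -/
abbrev strand (n : ℕ) (r : ℤ) : Submodule K (R.P n →ₗ[A] A) :=
  gradedHom (R.component n) (intComponent 𝒜) r

/-- The coboundaries of `Hom_A(P, A)` of internal degree `r`. -/
abbrev strandCoboundaries (n : ℕ) (r : ℤ) : Submodule K (R.P n →ₗ[A] A) :=
  R.homCoboundaries A n ⊓ R.strand n r

variable {R} {n : ℕ} {r r' : ℤ}

theorem basis_mem_component (i : R.ι n) : R.basis n i ∈ R.component n n := by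
  simpa using R.basis_mem n i

theorem strand_eq_bot (h : n + r < 0) : R.strand n r = ⊥ :=
  gradedHom_eq_bot basis_mem_component h

theorem homD_mem_strand {f : R.P n →ₗ[A] A} (hf : f ∈ R.strand n r) :
    R.homD A n f ∈ R.strand (n + 1) r :=
  fun q x hx => mem_gradedHom.1 hf q _ (R.d_mem n q x hx)

variable [GradedAlgebra 𝒜]

variable (R n r) in
theorem nonempty_strand_equiv : Nonempty (R.strand n r ≃ₗ[K] (R.ι n → intComponent 𝒜 (n + r))) :=
  nonempty_gradedHom_equiv (𝒜 := 𝒜) basis_mem_component r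

theorem finite_strand [Finite (R.ι n)] [Module.Finite K (intComponent 𝒜 (n + r))] :
    Module.Finite K (R.strand n r) := by
  obtain ⟨e⟩ := R.nonempty_strand_equiv n r
  exact Module.Finite.equiv e.symm

variable (R n r) in
theorem finrank_strand [Finite (R.ι n)] [Module.Finite K (intComponent 𝒜 (n + r))] :
    Module.finrank K (R.strand n r) =
      Nat.card (R.ι n) * Module.finrank K (intComponent 𝒜 (n + r)) := by
  obtain ⟨e⟩ := R.nonempty_strand_equiv n r
  have := Fintype.ofFinite (R.ι n)
  rw [e.finrank_eq, Module.finrank_pi_fintype, Finset.sum_const, Finset.card_univ,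
    Nat.card_eq_fintype_card, smul_eq_mul]

/-- This covers both that the complex `Hom_A(P, A)` is the direct sum of its strands, taking
`g = 0`, and that a class in one strand determines no class in another one. -/
theorem exists_homD_eq_of_sub_eq {f g : R.P (n + 1) →ₗ[A] A} {h : R.P n →ₗ[A] A}
    (hf : f ∈ R.strand (n + 1) r) (hg : g ∈ R.strand (n + 1) r') (hr : r ≠ r')
    (hfg : R.homD A n h = f - g) : ∃ h' ∈ R.strand n r, R.homD A n h' = f := by
  obtain ⟨h', hh', happly⟩ := exists_gradedHom_apply_eq_homogeneousPart 𝒜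
    basis_mem_component h r
  refine ⟨h', hh', (R.basis (n + 1)).ext fun i => ?_⟩
  have hi := basis_mem_component i
  calc h' (R.d n (R.basis (n + 1) i))
      = homogeneousPart 𝒜 ((n + 1 : ℕ) + r) (h (R.d n (R.basis (n + 1) i))) :=
        happly _ _ (R.d_mem n _ _ hi)
    _ = homogeneousPart 𝒜 ((n + 1 : ℕ) + r) (f (R.basis (n + 1) i) - g (R.basis (n + 1) i)) :=
        congrArg _ (LinearMap.congr_fun hfg _)
    _ = f (R.basis (n + 1) i) := by
        rw [map_sub, homogeneousPart_of_mem (mem_gradedHom.1 hf _ _ hi),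
          homogeneousPart_of_mem_ne (mem_gradedHom.1 hg _ _ hi) (by simpa using hr.symm), sub_zero]

variable (R n r) in
theorem map_strand : (R.strand n r).map (R.homD A n) = R.strandCoboundaries (n + 1) r := by
  refine le_antisymm ?_ ?_
  · rintro _ ⟨f, hf, rfl⟩
    exact ⟨LinearMap.mem_range_self _ f, homD_mem_strand hf⟩
  · rintro f ⟨⟨h, hh⟩, hf⟩
    exact exists_homD_eq_of_sub_eq hf (zero_mem _) (lt_add_one r).ne (hh.trans (sub_zero f).symm)

theorem mem_homCoboundaries_of_sub_mem {f g : R.P n →ₗ[A] A} (hf : f ∈ R.strand n r)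
    (hg : g ∈ R.strand n r') (hr : r ≠ r') (hfg : f - g ∈ R.homCoboundaries A n) :
    f ∈ R.homCoboundaries A n := by
  cases n with
  | zero =>
    obtain rfl : f = g := sub_eq_zero.1 hfg
    exact eq_zero_of_mem_gradedHom_of_ne basis_mem_component hr hf hg
  | succ n =>
    obtain ⟨h, hh⟩ := hfg
    obtain ⟨h', -, hh'⟩ := exists_homD_eq_of_sub_eq hf hg hr hh
    exact ⟨h', hh'⟩

variable (R n) in
/-- The internal degrees in `Hom_A(P n, A)` start at `-n`. -/
theorem strandCoboundaries_neg : R.strandCoboundaries n (-n) = ⊥ := by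
  cases n with
  | zero => exact bot_inf_eq _
  | succ n => rw [← map_strand, strand_eq_bot (by push_cast; lia), Submodule.map_bot]

end Strand

end LinearResolution

section Counting

theorem sum_range_neg_one_pow_mul_of_add {a b : ℕ → ℤ} {d : ℕ} (h0 : b 0 = 0)
    (h : ∀ n < d, a n = b (n + 1) + b n) :
    ∑ n ∈ Finset.range (d + 1), (-1) ^ n * a n = (-1) ^ d * (a d - b d) := by
  have hsum : ∑ n ∈ Finset.range d, (-1) ^ n * a n = -((-1) ^ d * b d) := calc
    _ = ∑ n ∈ Finset.range d, ((-1) ^ n * b n - (-1) ^ (n + 1) * b (n + 1)) :=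
        Finset.sum_congr rfl fun n hn => by rw [h n (Finset.mem_range.1 hn)]; ring
    _ = _ := by rw [Finset.sum_range_sub', h0, mul_zero, zero_sub]
  rw [Finset.sum_range_succ, hsum]
  ring

end Counting

section Connected

variable {K : Type v} {A : Type u} [Field K] [Ring A] [Algebra K A] {𝒜 : ℕ → Submodule K A}

theorem IsConnectedGraded.finrank_zero (h𝒜 : IsConnectedGraded 𝒜) : Module.finrank K (𝒜 0) = 1 := by
  have := h𝒜.1
  rw [h𝒜.2, Submodule.one_eq_span, finrank_span_singleton one_ne_zero]

theorem IsConnectedGraded.nontrivial_intComponent_add_neg (h𝒜 : IsConnectedGraded 𝒜) (n : ℤ) :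
    Nontrivial (intComponent 𝒜 (n + -n)) := by
  rw [add_neg_cancel]
  exact Module.nontrivial_of_finrank_pos (R := K) (h𝒜.finrank_zero ▸ one_pos)

end Connected

namespace LinearResolution

section Gorenstein

variable {K : Type v} {A : Type u} [Field K] [Ring A] [Algebra K A] {𝒜 : ℕ → Submodule K A}
  {N : Type u} [AddCommGroup N] [Module A N] [Module K N] {𝒩 : ℕ → Submodule K N}

theorem homCoboundaries_le_ker_homD {s : ℕ} (R : LinearResolution 𝒜 𝒩 s) {Y : Type u}
    [AddCommGroup Y] [Module K Y] [Module A Y] [IsScalarTower K A Y] (n : ℕ) :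
    R.homCoboundaries Y n ≤ LinearMap.ker (R.homD Y n) := by
  cases n with
  | zero => exact bot_le
  | succ n =>
    rintro _ ⟨f, rfl⟩
    exact LinearMap.ext fun x => (congrArg f ((R.exact_succ n).apply_apply_eq_zero x)).trans
      (map_zero f)

theorem homD_eq_zero_of_isEmpty {s : ℕ} (R : LinearResolution 𝒜 𝒩 s) {Y : Type u}
    [AddCommGroup Y] [Module K Y] [Module A Y] [IsScalarTower K A Y] (n : ℕ)
    [IsEmpty (R.ι (n + 1))] : R.homD Y n = 0 :=
  LinearMap.ext fun _ => (R.basis (n + 1)).ext isEmptyElim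

theorem nonempty_ι_of_nontrivial_ext {s : ℕ} (R : LinearResolution 𝒜 𝒩 s) {Y : Type u}
    [AddCommGroup Y] [Module K Y] [Module A Y] [IsScalarTower K A Y] {n : ℕ}
    (h : Nontrivial (Abelian.Ext (ModuleCat.of A N) (ModuleCat.of A Y) n)) : Nonempty (R.ι n) := by
  by_contra hι
  have := not_nonempty_iff.1 hι
  have : Subsingleton (R.P n →ₗ[A] Y) := ⟨fun f g => (R.basis n).ext isEmptyElim⟩
  exact not_subsingleton _ (R.extClass_surjective Y n).subsingleton

variable {R : LinearResolution 𝒜 𝒩 0} {d n : ℕ} {r : ℤ}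

variable (R d) in
/-- The extension class of an element of `Hom_A(P d, A)`, all of which are cocycles as
`P (d + 1) = 0`. -/
def topClass [IsEmpty (R.ι (d + 1))] :
    (R.P d →ₗ[A] A) →ₗ[K] Abelian.Ext (ModuleCat.of A N) (ModuleCat.of A A) d :=
  R.extClass A d ∘ₗ LinearMap.id.codRestrict _ fun f =>
    LinearMap.congr_fun (R.homD_eq_zero_of_isEmpty d) f

theorem topClass_eq_zero_iff [IsEmpty (R.ι (d + 1))] {f : R.P d →ₗ[A] A} :
    R.topClass d f = 0 ↔ f ∈ R.homCoboundaries A d :=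
  R.extClass_eq_zero_iff _

theorem ker_homD_inf_strand
    [Subsingleton (Abelian.Ext (ModuleCat.of A N) (ModuleCat.of A A) n)] :
    LinearMap.ker (R.homD A n) ⊓ R.strand n r = R.strandCoboundaries n r :=
  congrArg (· ⊓ R.strand n r)
    ((R.ker_homD_le_homCoboundaries A).antisymm (R.homCoboundaries_le_ker_homD n))

theorem finite_map_applyₗ_strand [Module.Finite K (intComponent 𝒜 (n + r))] (x : R.P n) :
    Module.Finite K ((R.strand n r).map (LinearMap.applyₗ' K x)) := by
  let c := (R.basis n).repr x
  have hle : (R.strand n r).map (LinearMap.applyₗ' K x) ≤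
      ⨆ j : c.support, (intComponent 𝒜 (n + r)).map (LinearMap.mulLeft K (c j)) := by
    rintro _ ⟨g, hg, rfl⟩
    change g x ∈ _
    rw [← (R.basis n).linearCombination_repr x, Finsupp.linearCombination_apply, Finsupp.sum,
      map_sum]
    refine sum_mem fun j hj => Submodule.mem_iSup_of_mem ⟨j, hj⟩
      ⟨_, mem_gradedHom.1 hg n (R.basis n j) (basis_mem_component j), ?_⟩
    exact (map_smul g _ _).symm
  exact Submodule.finiteDimensional_of_le hle

variable [GradedAlgebra 𝒜]

theorem finite_ι_of_finite_strand (h𝒜 : IsConnectedGraded 𝒜)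
    [Module.Finite K (R.strand n (-n))] : Finite (R.ι n) := by
  have := h𝒜.nontrivial_intComponent_add_neg n
  obtain ⟨e⟩ := R.nonempty_strand_equiv n (-n)
  exact finite_of_finite_pi (Module.Finite.equiv e)

section Top

variable (R) (h𝒜 : IsConnectedGraded 𝒜) [IsEmpty (R.ι (d + 1))]
  (e : Abelian.Ext (ModuleCat.of A N) (ModuleCat.of A A) d ≃ₗ[K] K)

include h𝒜 e

/-- The strand of degree `-d` contains no coboundaries, so the one-dimensional top cohomology
leaves no room outside it. -/
theorem bijective_topClass_strand :
    Function.Bijective (e.toLinearMap ∘ₗ (R.topClass d).domRestrict (R.strand d (-d))) := by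
  have hinj : Function.Injective
      (e.toLinearMap ∘ₗ (R.topClass d).domRestrict (R.strand d (-d))) := by
    refine (injective_iff_map_eq_zero _).2 fun f hf => Subtype.ext ?_
    have h0 : f.1 ∈ R.strandCoboundaries d (-d) :=
      ⟨topClass_eq_zero_iff.1 ((LinearEquiv.map_eq_zero_iff e).1 hf), f.2⟩
    rwa [R.strandCoboundaries_neg d] at h0
  refine ⟨hinj, LinearMap.surjective fun h0 => ?_⟩
  have := R.nonempty_ι_of_nontrivial_ext e.toEquiv.nontrivial
  have := h𝒜.nontrivial_intComponent_add_neg d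
  obtain ⟨e'⟩ := R.nonempty_strand_equiv d (-d)
  have := e'.toEquiv.nontrivial
  obtain ⟨f, hf⟩ := exists_ne (0 : R.strand d (-d))
  exact hf (hinj (by rw [h0]; rfl))

theorem finrank_strand_top : Module.finrank K (R.strand d (-d)) = 1 := by
  rw [(LinearEquiv.ofBijective _ (R.bijective_topClass_strand h𝒜 e)).finrank_eq,
    Module.finrank_self]

theorem strand_le_homCoboundaries (hr : r + d ≠ 0) : R.strand d r ≤ R.homCoboundaries A d :=
  fun f hf => by
    obtain ⟨⟨g, hg⟩, hfg⟩ := (R.bijective_topClass_strand h𝒜 e).2 (e (R.topClass d f))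
    refine mem_homCoboundaries_of_sub_mem hf hg (by lia) (topClass_eq_zero_iff.1 ?_)
    rw [map_sub, sub_eq_zero]
    exact (e.injective hfg).symm

theorem finite_ι_top : Finite (R.ι d) := by
  have : Module.Finite K (R.strand d (-d)) :=
    .equiv (LinearEquiv.ofBijective _ (R.bijective_topClass_strand h𝒜 e)).symm
  exact finite_ι_of_finite_strand h𝒜

include R in
/-- An element `a` of degree `m + 1` is the value at a basis element of an `A`-linear map
`P d → A`; that map lies in a strand consisting of coboundaries, and coboundaries are determined
by values of degree `m`. -/
theorem finite_component_succ {m : ℕ} [Module.Finite K (𝒜 m)] : Module.Finite K (𝒜 (m + 1)) := by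
  obtain ⟨i⟩ := R.nonempty_ι_of_nontrivial_ext e.toEquiv.nontrivial
  have hle : 𝒜 (m + 1) ≤
      (R.strandCoboundaries d (m + 1 - d)).map (LinearMap.applyₗ' K (R.basis d i)) := fun a ha => by
    have hf : (R.basis d).constr K (fun _ => a) ∈ R.strand d (m + 1 - d) :=
      constr_mem_gradedHom 𝒜 basis_mem_component fun _ => by
        rwa [add_sub_cancel]
    exact ⟨_, ⟨R.strand_le_homCoboundaries h𝒜 e (by lia) hf, hf⟩, (R.basis d).constr_basis K _ i⟩
  suffices Module.Finite K
      ((R.strandCoboundaries d (m + 1 - d)).map (LinearMap.applyₗ' K (R.basis d i))) from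
    Submodule.finiteDimensional_of_le hle
  cases d with
  | zero =>
    rw [show R.strandCoboundaries 0 _ = ⊥ from bot_inf_eq _, Submodule.map_bot]
    infer_instance
  | succ n =>
    have : Module.Finite K (intComponent 𝒜 (n + (m + 1 - (n + 1 : ℕ)))) := by
      rw [show (n : ℤ) + (m + 1 - (n + 1 : ℕ)) = Int.ofNat m by simp]
      assumption
    rw [← R.map_strand, ← Submodule.map_comp]
    exact finite_map_applyₗ_strand (R.d n (R.basis (n + 1) i))

include R in
theorem finite_component (m : ℕ) : Module.Finite K (𝒜 m) := by
  induction m with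
  | zero => exact Module.finite_of_finrank_pos (h𝒜.finrank_zero ▸ one_pos)
  | succ m ih => exact R.finite_component_succ h𝒜 e

end Top

end Gorenstein

section GorensteinCount

variable {K : Type v} {A : Type u} [Field K] [Ring A] [Algebra K A] {𝒜 : ℕ → Submodule K A}
  {N : Type u} [AddCommGroup N] [Module A N] [Module K N] {𝒩 : ℕ → Submodule K N}
  {R : LinearResolution 𝒜 𝒩 0} [GradedAlgebra 𝒜] {d : ℕ}

theorem finite_ι_of_finite_ι_succ (h𝒜 : IsConnectedGraded 𝒜) {n : ℕ}
    [Subsingleton (Abelian.Ext (ModuleCat.of A N) (ModuleCat.of A A) n)]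
    [∀ m, Module.Finite K (𝒜 m)] [Finite (R.ι (n + 1))] : Finite (R.ι n) := by
  have hker : LinearMap.ker (R.homD A n) ⊓ R.strand n (-n) = ⊥ := by
    rw [ker_homD_inf_strand, strandCoboundaries_neg]
  have := R.finite_strand (n := n + 1) (r := -n)
  have := finite_of_map_le ((R.map_strand n (-n)).trans_le inf_le_right) hker
  exact finite_ι_of_finite_strand h𝒜

variable (R) (h𝒜 : IsConnectedGraded 𝒜) [IsEmpty (R.ι (d + 1))]
  (e : Abelian.Ext (ModuleCat.of A N) (ModuleCat.of A A) d ≃ₗ[K] K)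
  (hext : ∀ n < d, Subsingleton (Abelian.Ext (ModuleCat.of A N) (ModuleCat.of A A) n))

include h𝒜 e hext

theorem finite_ι_of_le {n : ℕ} (hn : n ≤ d) : Finite (R.ι n) := by
  have := R.finite_component h𝒜 e
  induction hn using Nat.decreasingInduction with
  | self => exact R.finite_ι_top h𝒜 e
  | of_succ n hn ih =>
    have := hext n hn
    exact finite_ι_of_finite_ι_succ h𝒜

theorem sum_card_ι_mul_finrank_intComponent (r : ℤ) :
    ∑ n ∈ Finset.range (d + 1),
        (-1 : ℤ) ^ n * (Nat.card (R.ι n) * Module.finrank K (intComponent 𝒜 (n + r))) =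
      if r + d = 0 then (-1) ^ d else 0 := by
  have := R.finite_component h𝒜 e
  have hfin (n : ℕ) (hn : n ≤ d) : Finite (R.ι n) := R.finite_ι_of_le h𝒜 e hext hn
  let v (n : ℕ) : ℤ := Module.finrank K (R.strand n r)
  let b (n : ℕ) : ℤ := Module.finrank K (R.strandCoboundaries n r)
  have hb0 : b 0 = 0 := by
    change (Module.finrank K (R.strandCoboundaries 0 r) : ℤ) = 0
    rw [show R.strandCoboundaries 0 r = ⊥ from bot_inf_eq _, finrank_bot, Nat.cast_zero]
  have hv : ∀ n < d, v n = b (n + 1) + b n := fun n hn => by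
    have := hext n hn
    have := hfin n hn.le
    have := R.finite_strand (n := n) (r := r)
    have h := finrank_map_add_finrank_inf_ker (R.homD A n) (R.strand n r)
    rw [R.map_strand, ker_homD_inf_strand] at h
    exact (congrArg Nat.cast h.symm).trans (Nat.cast_add _ _)
  calc
    _ = ∑ n ∈ Finset.range (d + 1), (-1) ^ n * v n := Finset.sum_congr rfl fun n hn => by
      have := hfin n (Finset.mem_range_succ_iff.1 hn)
      rw [← Nat.cast_mul, ← R.finrank_strand]
    _ = (-1) ^ d * (v d - b d) := sum_range_neg_one_pow_mul_of_add hb0 hv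
    _ = if r + d = 0 then (-1) ^ d else 0 := by
      split_ifs with hr
      · obtain rfl : r = -d := by lia
        have hvd : v d = 1 := congrArg Nat.cast (R.finrank_strand_top h𝒜 e)
        have hbd : b d = 0 := by
          change (Module.finrank K (R.strandCoboundaries d (-d)) : ℤ) = 0
          rw [R.strandCoboundaries_neg, finrank_bot, Nat.cast_zero]
        rw [hvd, hbd, sub_zero, mul_one]
      · have hvb : v d = b d :=
          congrArg (fun p : Submodule K (R.P d →ₗ[A] A) => (Module.finrank K p : ℤ))
            (inf_eq_right.2 (R.strand_le_homCoboundaries h𝒜 e hr)).symm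
        rw [hvb, sub_self, mul_zero]

end GorensteinCount

end LinearResolution

section Main

theorem subsingleton_ext_of_globalDimension {A : Type u} [Ring A] {d n : ℕ}
    (h : globalDimension A = d) (hn : d < n) (X Y : ModuleCat.{u} A) :
    Subsingleton (Abelian.Ext X Y n) := by
  have hX : projectiveDimension X ≤ d :=
    h ▸ le_iSup (fun M : ModuleCat.{u} A => projectiveDimension M) X
  have := (projectiveDimension_le_iff X d).1 hX
  exact HasProjectiveDimensionLT.subsingleton X (d + 1) n hn Y

variable {K : Type v} {A : Type u} [Field K] [Ring A] [Algebra K A] {𝒜 : ℕ → Submodule K A}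
  [GradedAlgebra 𝒜] {d : ℕ} {r χ : ℤ}

theorem IsWeaklyASRegular.hasEulerChar (h𝒜 : IsWeaklyASRegular 𝒜 d) (hK : IsKoszul 𝒜) :
    HasEulerChar (bimoduleComplex 𝒜 (truncation 𝒜 0) r) d
      (if r + d = 0 then (-1) ^ d else 0) := by
  obtain ⟨R⟩ := hK.nonempty_linearResolution h𝒜.connected
  obtain ⟨⟨e⟩, hext⟩ := h𝒜.gorenstein
  have := h𝒜.connected.trivialModuleEquiv.symm.toEquiv.nontrivial
  have hd (n : ℕ) (hn : d < n) : IsEmpty (R.ι n) :=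
    R.isEmpty_ι_of_subsingleton_ext (subsingleton_ext_of_globalDimension h𝒜.globalDimension_eq hn
      _ (ModuleCat.of A (TrivialModule 𝒜)))
  have := hd (d + 1) (lt_add_one d)
  have hlt (n : ℕ) (hn : n < d) := hext n hn.ne
  have := R.finite_component h𝒜.connected e
  have (n : ℕ) : Finite (R.ι n) := (le_or_gt n d).elim (R.finite_ι_of_le h𝒜.connected e hlt)
    fun hn => have := hd n hn; inferInstance
  have htrunc (n : ℕ) : Module.finrank K (intComponent 𝒜 (n + r)) =
      Module.finrank K (truncation 𝒜 0 (n + r)) := by rw [truncation_zero]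
  rw [← R.sum_card_ι_mul_finrank_intComponent h𝒜.connected e hlt r]
  simp only [htrunc]
  exact R.hasEulerChar_truncation h𝒜.connected h𝒜.connected.trivialModuleEquiv hd 0

theorem HasEulerChar.subsingleton_HH (h : HasEulerChar (bimoduleComplex 𝒜 (truncation 𝒜 0) r) d χ)
    {i : ℤ} (hi : i < 0 ∨ d < i) : Subsingleton (HH 𝒜 i r) := by
  rcases lt_or_ge i 0 with h0 | h0
  · exact subsingleton_HH_of_neg h0 r
  · lift i to ℕ using h0
    have := h.subsingleton i (by lia)
    obtain ⟨e⟩ := nonempty_HH_equiv 𝒜 i r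
    exact e.toEquiv.subsingleton

theorem HasEulerChar.finite_HH (h : HasEulerChar (bimoduleComplex 𝒜 (truncation 𝒜 0) r) d χ)
    (i : ℤ) : Module.Finite K (HH 𝒜 i r) := by
  rcases lt_or_ge i 0 with h0 | h0
  · have := subsingleton_HH_of_neg (𝒜 := 𝒜) h0 r
    infer_instance
  · lift i to ℕ using h0
    have := h.finite i
    obtain ⟨e⟩ := nonempty_HH_equiv 𝒜 i r
    exact Module.Finite.equiv e.symm

theorem HasEulerChar.sum_finrank_HH
    (h : HasEulerChar (bimoduleComplex 𝒜 (truncation 𝒜 0) r) d χ) :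
    ∑ i ∈ Finset.range (d + 1), (-1 : ℤ) ^ i * Module.finrank K (HH 𝒜 i r) = χ := by
  rw [← h.sum_eq]
  refine Finset.sum_congr rfl fun i _ => ?_
  obtain ⟨e⟩ := nonempty_HH_equiv 𝒜 i r
  rw [e.finrank_eq]

end Main

end GradedHochschild

end

theorem proposition2p5 {K : Type v} {A : Type u} [Field K] [Ring A] [Algebra K A]
    (𝒜 : ℕ → Submodule K A) [GradedAlgebra 𝒜] (d : ℕ)
    (hKoszul : GradedHochschild.IsKoszul 𝒜)
    (hRegular : GradedHochschild.IsWeaklyASRegular 𝒜 d) :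
    (∀ i r : ℤ, i < 0 ∨ (d : ℤ) < i → Subsingleton (GradedHochschild.HH 𝒜 i r)) ∧
    (∀ i r : ℤ, Module.Finite K (GradedHochschild.HH 𝒜 i r)) ∧
    (∀ r : ℤ, ∑ i ∈ Finset.range (d + 1),
        (-1 : ℤ) ^ i * (Module.finrank K (GradedHochschild.HH 𝒜 (i : ℤ) r) : ℤ) =
      if r + (d : ℤ) = 0 then (-1 : ℤ) ^ d else 0) ∧
    (d ≠ 0 → ∑ i ∈ Finset.range (d + 1),
        (-1 : ℤ) ^ i * (Module.finrank K (GradedHochschild.HH 𝒜 (i : ℤ) 0) : ℤ) = 0) := by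
  have h (r : ℤ) := hRegular.hasEulerChar hKoszul (r := r)
  exact ⟨fun i r hi => (h r).subsingleton_HH hi, fun i r => (h r).finite_HH i,
    fun r => (h r).sum_finrank_HH,
    fun hd => (h 0).sum_finrank_HH.trans (if_neg (by lia))⟩
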